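/- **Setting.** Let $\varphi:\mathbb R\to\mathbb R$ (the cumulant generating function of a generalized linear model) be five times continuously differentiable with $|\varphi^{(j)}|\le B_j$ on $\mathbb R$ for $j=2,3,4,5$. Let $p\ge 2$, $0\le r<p$, $1\le s\le n$, $K,R>0$, and write $B_p(R)=\{\beta\in\mathbb R^p:\|\beta\|_2\le R\}$. The covariates $x_1,\dots,x_n\in\mathbb R^p$ are i.i.d. random vectors with $\|x_i\|_2\le\sqrt K$ almost surely, $\mathbb E[x_i]=0$ and $\mathbb E[x_ix_i^T]=\Sigma$, where $\Sigma$ follows the $r$-spiked model $\Sigma=\sigma^2 I+\sum_{i=1}^r\theta_iu_iu_i^T$ with $\sigma>0$, $\theta_i\ge 0$ and orthonormal $u_1,\dots,u_r$. The responses $y_1,\dots,y_n$ are real random variables, and $$\ell(\beta)=\frac1n\sum_{i=1}^n\big[\varphi(\langle x_i,\beta\rangle)-y_i\langle x_i,\beta\rangle\big].$$ For $k=2,4$ put $\mu_k(\beta)=\mathbb E[\varphi^{(k)}(\langle x,\beta\rangle)]$ (where $x$ is distributed as the $x_i$) and $\hat\mu_k(\beta)=\frac1n\sum_{i=1}^n\varphi^{(k)}(\langle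 x_i,\beta\rangle)$, and let $m>0$ satisfy $\mu_2(\beta)\ge m$ for all $\beta\in B_p(R)$. **Algorithm.** Let $S\subset\{1,\dots,n\}$ be a uniformly random subset of size $|S|=s$, independent of the covariates, and $\widehat\Sigma_S=\frac1{|S|}\sum_{i\in S}x_ix_i^T$. Let $\zeta=\zeta_r(\widehat\Sigma_S)$ be the matrix obtained from $\widehat\Sigma_S$ by keeping its eigenvectors and its $r$ largest eigenvalues and replacing every other eigenvalue by the $(r+1)$-st largest one. Given a deterministic $\hat\beta^0\in\mathbb R^p$, the Newton-Stein iterates with step size $\gamma=1$ are $$\hat\beta^{t+1}=\mathcal P_{B_p(R)}\big(\hat\beta^t-Q^t\nabla\ell(\hat\beta^t)\big),\qquad Q^t=\frac1{\hat\mu_2(\hat\beta^t)}\Big[\zeta^{-1}-\frac{\hat\mu_4(\hat\beta^t)\,\hat\beta^t(\hat\beta^t)^T}{\hat\mu_2(\hat\beta^t)+\hat\mu_4(\hat\beta^t)\langle\zeta\hat\beta^t,\hat\beta^t\rangle}\Big],$$ where $\mathcal P_{B_p(R)}$ is the Euclidean projection onto $B_p(R)$. Fix $t\ge 0$, and if $t=0$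 assume $\hat\beta^0\in B_p(R)$. Let $\beta_*$ be a random vector, the optimal value, and for $\xi>0$ let $$\mathcal E=\Big\{\big|\mu_2(\hat\beta^t)+\mu_4(\hat\beta^t)\langle\Sigma\hat\beta^t,\hat\beta^t\rangle\big|>\xi,\ \ \beta_*\text{ minimizes }\ell\text{ over }\mathbb R^p,\ \ \beta_*\in B_p(R)\Big\}.$$ **Distance to the Gaussian.** Let $z\sim N_p(0,\Sigma)$, let $d_{\mathcal H}(x,z)=\sup_{h\in\mathcal H}|\mathbb E h(x)-\mathbb E h(z)|$, and let $\mathcal H_1=\{v\mapsto\varphi^{(2)}(\langle v,\beta\rangle):\beta\in B_p(R)\}$, $\mathcal H_2=\{v\mapsto\varphi^{(4)}(\langle v,\beta\rangle):\beta\in B_p(R)\}$, $\mathcal H_3=\{v\mapsto\langle w,v\rangle^2\varphi^{(2)}(\langle v,\beta\rangle):\beta\in B_p(R),\|w\|_2=1\}$. Put $$\mathfrak D(x,z)=\|\Sigma\|_2\,d_{\mathcal H_1}(x,z)+\|\Sigma\|_2^2R^2\,d_{\mathcal H_2}(x,z)+d_{\mathcal H_3}(x,z).$$ **Theorem.** For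 all $K,R,\pi_0>0$ and $B_2,B_4$ there are constants $c,c_1,c_2>0$, depending only on $K,R,\pi_0,B_2,B_4$, such that the following holds. Let $n$ and $|S|$ be sufficiently large, that is $n\ge N$ and $|S|\ge N$, where $N$ depends only on $K,R,\pi_0,B_2,B_3,B_4,B_5,p,r,\sigma,\xi,m$. If $\mathbb P(\mathcal E)\ge\pi_0$, then, conditioned on the event $\mathcal E$, with probability at least $1-c/p^2$, $$\|\hat\beta^{t+1}-\beta_*\|_2\le\tau_1\|\hat\beta^t-\beta_*\|_2+\tau_2\|\hat\beta^t-\beta_*\|_2^2,$$ where $$\tau_1=\kappa\,\mathfrak D(x,z)+c_1\kappa\sqrt{\frac p{\min\{p|S|/\log p,\;n/\log n\}}},\qquad\tau_2=c_2\kappa,\qquad\kappa=\frac2m\Big[\frac2{\sigma^2}+\frac{2B_4R^2}{\xi}\Big].$$ -/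

import Mathlib

open MeasureTheory ProbabilityTheory Matrix
open scoped RealInnerProductSpace

noncomputable section

namespace NewtonStein

/-- `ℝ^p` with the Euclidean norm. -/
abbrev Vec (p : ℕ) : Type := EuclideanSpace ℝ (Fin p)

/-- The rank-one matrix `v vᵀ`. -/
def outer {p : ℕ} (v : Vec p) : Matrix (Fin p) (Fin p) ℝ :=
  Matrix.of fun j k => v j * v k

lemma outer_isHermitian {p : ℕ} (v : Vec p) : (outer v).IsHermitian := by
  ext j k
  simp [outer, mul_comm]

/-- A matrix acting on column vectors. -/
def act {p : ℕ} (A : Matrix (Fin p) (Fin p) ℝ) (v : Vec p) : Vec p :=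
  Matrix.toEuclideanCLM (𝕜 := ℝ) A v

/-- The spectral norm (operator norm for the Euclidean norm). -/
def specNorm {p : ℕ} (A : Matrix (Fin p) (Fin p) ℝ) : ℝ :=
  ‖Matrix.toEuclideanCLM (𝕜 := ℝ) A‖

/-- The `r`-spiked covariance model with noise level `σ²`:
`Σ = σ² I + ∑_{i ≤ r} θ_i u_i u_iᵀ` with orthonormal `u_i` and `θ_i ≥ 0`. -/
def IsSpiked {p : ℕ} (r : ℕ) (σ : ℝ) (Sig : Matrix (Fin p) (Fin p) ℝ) : Prop :=
  ∃ (θ : Fin r → ℝ) (u : Fin r → Vec p), (∀ i, 0 ≤ θ i) ∧ Orthonormal ℝ u ∧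
    Sig = σ ^ 2 • (1 : Matrix (Fin p) (Fin p) ℝ) + ∑ i, θ i • outer (u i)

/-! ### Generalized linear models -/

/-- The (normalized) negative log-likelihood
`ℓ(β) = (1/n) ∑ᵢ [φ(⟨xᵢ, β⟩) - yᵢ ⟨xᵢ, β⟩]`. -/
def negLogLik {n p : ℕ} (φ : ℝ → ℝ) (x : Fin n → Vec p) (y : Fin n → ℝ) (β : Vec p) : ℝ :=
  (n : ℝ)⁻¹ * ∑ i, (φ ⟪x i, β⟫ - y i * ⟪x i, β⟫)

/-- The population quantity `μ_k(β) = 𝔼 φ^{(k)}(⟨x, β⟩)` for a covariate `x` of law `ρ`. -/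
def popMu {p : ℕ} (k : ℕ) (φ : ℝ → ℝ) (ρ : Measure (Vec p)) (β : Vec p) : ℝ :=
  ∫ v, iteratedDeriv k φ ⟪v, β⟫ ∂ρ

/-- The sample mean `(1/n) ∑ᵢ φ^{(k)}(⟨xᵢ, β⟩)`. -/
def empMu {n p : ℕ} (k : ℕ) (φ : ℝ → ℝ) (x : Fin n → Vec p) (β : Vec p) : ℝ :=
  (n : ℝ)⁻¹ * ∑ i, iteratedDeriv k φ ⟪x i, β⟫

/-! ### The Newton-Stein method -/

/-- The sub-sampled covariance estimator `(1/|S|) ∑_{i ∈ S} xᵢ xᵢᵀ`. -/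
def subCov {n p : ℕ} (x : Fin n → Vec p) (S : Finset (Fin n)) : Matrix (Fin p) (Fin p) ℝ :=
  (S.card : ℝ)⁻¹ • ∑ i ∈ S, outer (x i)

lemma subCov_isHermitian {n p : ℕ} (x : Fin n → Vec p) (S : Finset (Fin n)) :
    (subCov x S).IsHermitian := by
  have h : (∑ i ∈ S, outer (x i)).IsHermitian := by
    unfold Matrix.IsHermitian
    rw [Matrix.conjTranspose_sum]
    exact Finset.sum_congr rfl fun i _ => outer_isHermitian (x i)
  unfold Matrix.IsHermitian subCov
  rw [Matrix.conjTranspose_smul, h.eq, star_trivial]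

/-- `λ_{r+1}(A)`, the `(r+1)`-st largest eigenvalue, counted with multiplicity, of a symmetric
matrix (`eigenvalues₀` is the decreasing enumeration, starting at index `0`). -/
def eigNext {p : ℕ} {A : Matrix (Fin p) (Fin p) ℝ} (hA : A.IsHermitian) (r : Fin p) : ℝ :=
  hA.eigenvalues₀ (r.cast (Fintype.card_fin p).symm)

/-- Eigenvalue thresholding `ζ_r(A)`: the `r` largest eigenvalues are kept and all the others are
set to `λ_{r+1}(A)`, with unchanged eigenvectors. Every eigenvalue `λ` thus becomes
`max λ λ_{r+1}(A)`. -/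
def eigThreshold {p : ℕ} {A : Matrix (Fin p) (Fin p) ℝ} (hA : A.IsHermitian) (r : Fin p) :
    Matrix (Fin p) (Fin p) ℝ :=
  ∑ j, max (hA.eigenvalues j) (eigNext hA r) • outer (hA.eigenvectorBasis j)

/-- The scaling matrix
`Q = μ̂₂⁻¹ [ζ⁻¹ - β βᵀ / (μ̂₂/μ̂₄ + ⟨ζ β, β⟩)]`, with the fraction expanded by `μ̂₄` so that it is
also meaningful (and equal to `0`) for `μ̂₄ = 0`. -/
def scaling {n p : ℕ} (φ : ℝ → ℝ) (x : Fin n → Vec p) (ζ : Matrix (Fin p) (Fin p) ℝ)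
    (β : Vec p) : Matrix (Fin p) (Fin p) ℝ :=
  (empMu 2 φ x β)⁻¹ •
    (ζ⁻¹ - (empMu 4 φ x β / (empMu 2 φ x β + empMu 4 φ x β * ⟪act ζ β, β⟫)) • outer β)

/-- The Euclidean projection onto the closed ball of radius `R` around the origin. -/
def projBall {p : ℕ} (R : ℝ) (v : Vec p) : Vec p :=
  if ‖v‖ ≤ R then v else (R / ‖v‖) • v

/-- The iterates `β̂^t` of the Newton-Stein method with rank threshold `r`, step size `γ`,
sub-sample `S`, projection radius `R` and initial point `β₀`. -/
def iterate {n p : ℕ} (φ : ℝ → ℝ) (R γ : ℝ) (r : Fin p) (β₀ : Vec p)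
    (x : Fin n → Vec p) (y : Fin n → ℝ) (S : Finset (Fin n)) : ℕ → Vec p
  | 0 => β₀
  | t + 1 =>
    projBall R (iterate φ R γ r β₀ x y S t -
      γ • act (scaling φ x (eigThreshold (subCov_isHermitian x S) r)
            (iterate φ R γ r β₀ x y S t))
          (gradient (negLogLik φ x y) (iterate φ R γ r β₀ x y S t)))

/-- `S` is a sub-sample of size `s` of the index set, drawn uniformly at random. -/
def IsUniformSubsample {Ω : Type*} [MeasurableSpace Ω] {n : ℕ} (s : ℕ) (S : Ω → Finset (Fin n))
    (P : Measure Ω) : Prop :=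
  Measurable S ∧
    ∀ T : Finset (Fin n), P (S ⁻¹' {T}) = if T.card = s then ((n.choose s : ENNReal))⁻¹ else 0

/-! ### Probability metrics -/

/-- `d_H(ρ, ν) = sup_{h ∈ H} |∫ h dρ - ∫ h dν|`. -/
def dist {E : Type*} [MeasurableSpace E] (H : Set (E → ℝ)) (ρ ν : Measure E) : ℝ :=
  sSup ((fun h => |∫ v, h v ∂ρ - ∫ v, h v ∂ν|) '' H)

/-- The class of the functions `v ↦ φ^{(k)}(⟨v, β⟩)`, `‖β‖ ≤ R`. -/
def classDeriv (p k : ℕ) (φ : ℝ → ℝ) (R : ℝ) : Set (Vec p → ℝ) :=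
  {h | ∃ β : Vec p, ‖β‖ ≤ R ∧ h = fun v => iteratedDeriv k φ ⟪v, β⟫}

/-- The class of the functions `v ↦ ⟨w, v⟩² φ''(⟨v, β⟩)`, `‖β‖ ≤ R`, `‖w‖ = 1`. -/
def classHess (p : ℕ) (φ : ℝ → ℝ) (R : ℝ) : Set (Vec p → ℝ) :=
  {h | ∃ β w : Vec p, ‖β‖ ≤ R ∧ ‖w‖ = 1 ∧
    h = fun v => ⟪w, v⟫ ^ 2 * iteratedDeriv 2 φ ⟪v, β⟫}

/-- `𝔇(ρ, ν) = ‖Σ‖ d_{H₁}(ρ, ν) + ‖Σ‖² R² d_{H₂}(ρ, ν) + d_{H₃}(ρ, ν)`. -/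
def bigDist {p : ℕ} (φ : ℝ → ℝ) (R : ℝ) (Sig : Matrix (Fin p) (Fin p) ℝ)
    (ρ ν : Measure (Vec p)) : ℝ :=
  specNorm Sig * dist (classDeriv p 2 φ R) ρ ν +
    specNorm Sig ^ 2 * R ^ 2 * dist (classDeriv p 4 φ R) ρ ν +
    dist (classHess p φ R) ρ ν

/-- The event `{ |μ₂(β̂) + μ₄(β̂) ⟨Σ β̂, β̂⟩| > ξ, β* ∈ B_p(R) }` for a random point `β̂` and a
random vector `βs`, `β*` being the optimal value, i.e. a minimizer over `ℝ^p` of the negative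
log-likelihood `ℓ`. -/
def goodEvent {Ω : Type*} {p : ℕ} (φ : ℝ → ℝ) (ρ : Measure (Vec p))
    (Sig : Matrix (Fin p) (Fin p) ℝ) (R ξ : ℝ) (l : Ω → Vec p → ℝ) (βt βs : Ω → Vec p) : Set Ω :=
  {ω | ξ < |popMu 2 φ ρ (βt ω) + popMu 4 φ ρ (βt ω) * ⟪act Sig (βt ω), βt ω⟫| ∧
    IsMinOn (l ω) Set.univ (βs ω) ∧ ‖βs ω‖ ≤ R}

end NewtonStein

end

/-! For Gaussian `z` with covariance `Σ`, Stein's identity used twice gives `𝔼[φ''(⟨z,β⟩) z zᵀ] =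
𝔼[φ''(⟨z,β⟩)] Σ + 𝔼[φ''''(⟨z,β⟩)] Σβ(Σβ)ᵀ`. This is a multiple of `Σ` plus a rank-one matrix, which
the Sherman-Morrison formula inverts explicitly. The scaling matrix `Q` is that inverse with sample
means for the expectations and `ζ` for `Σ`.

Since the gradient vanishes at `β_*`, the error after one step, before projection, is `Q` applied to
`A(β - β_*)` minus a Taylor remainder of the gradient, where `A` is the matrix inverted by `Q` minus
the empirical Hessian. Bounding `‖Q‖` by `κ`, then `‖A‖` and the remainder, gives `τ₁` and `τ₂`;
projecting onto a ball that contains `β_*` does not increase the error (`norm_step_le`).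

The norm of `A` splits into the distance `𝔇` to the Gaussian (`abs_hess_sub_le_bigDist`) and
sampling errors. The error of the sub-sampled covariance passes to `ζ` by an eigenvalue comparison
(`IsSpiked.abs_inner_eigThreshold_sub_le`). The errors of `μ̂₂`, `μ̂₄` and the Hessian are bounded
uniformly over the ball, because the iterate depends on the data.

Concentration rests on a Hoeffding inequality in Hilbert spaces with no dimension factor
(`measure_norm_sum_ge_le`), applied to the tensors `v ⊗ v`, of Frobenius norm `‖v‖² ≤ K`. A single
mean then has error of order `√(log p / |S|)`; a union bound over a grid in the ball gives `√(p log
n / n)`. Four bad events have probability at most `3/p²` each, and conditioning on `𝓔` costs a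
factor of at most `1/π₀`. -/

noncomputable section

namespace NewtonStein

/-! ### A dimension-free Hoeffding inequality in Hilbert spaces -/

section Hoeffding

variable {E : Type*} [NormedAddCommGroup E] [InnerProductSpace ℝ E]

/-- `√(1 + ‖x‖²)` is a smooth substitute for the norm, and the vector in the inner product is its
gradient. With `a`, `b` the two square roots, the bound is `b ≤ (a² + b²)/(2a)`, and `a ≥ 1` removes
`a` from the quadratic term. -/
lemma sqrt_one_add_norm_add_sq_le (x y : E) :
    √(1 + ‖x + y‖ ^ 2) ≤ √(1 + ‖x‖ ^ 2) + ‖y‖ ^ 2 / 2 + ⟪(√(1 + ‖x‖ ^ 2))⁻¹ • x, y⟫ := by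
  have h1 : 1 ≤ √(1 + ‖x‖ ^ 2) := Real.one_le_sqrt.2 (by nlinarith [sq_nonneg ‖x‖])
  have h2 : √(1 + ‖x‖ ^ 2) ^ 2 = 1 + ‖x‖ ^ 2 := Real.sq_sqrt (by positivity)
  set a := √(1 + ‖x‖ ^ 2)
  have ha : 0 < a := by linarith
  have h3 := norm_add_sq_real x y
  have h4 := Real.sq_sqrt (show 0 ≤ 1 + ‖x + y‖ ^ 2 by positivity)
  set b := √(1 + ‖x + y‖ ^ 2)
  rw [real_inner_smul_left]
  have h5 : b ≤ a + ‖y‖ ^ 2 / (2 * a) + a⁻¹ * ⟪x, y⟫ := by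
    have : a + ‖y‖ ^ 2 / (2 * a) + a⁻¹ * ⟪x, y⟫ = (a ^ 2 + b ^ 2) / (2 * a) := by
      field_simp
      nlinarith
    rw [this, le_div_iff₀ (by positivity)]
    nlinarith [sq_nonneg (a - b)]
  have h6 : ‖y‖ ^ 2 / (2 * a) ≤ ‖y‖ ^ 2 / 2 := by
    apply div_le_div_of_nonneg_left (by positivity) (by norm_num) (by linarith)
  linarith

lemma norm_inv_sqrt_smul_le (x : E) : ‖(√(1 + ‖x‖ ^ 2))⁻¹ • x‖ ≤ 1 := by
  have h1 : ‖x‖ ≤ √(1 + ‖x‖ ^ 2) := Real.le_sqrt_of_sq_le (by linarith)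
  have h0 : 0 < √(1 + ‖x‖ ^ 2) := Real.sqrt_pos.2 (by positivity)
  rw [norm_smul, norm_inv, Real.norm_of_nonneg h0.le, inv_mul_le_iff₀ h0]
  linarith

variable [MeasurableSpace E] [BorelSpace E] [FiniteDimensional ℝ E]

/-- Hoeffding's scalar lemma for `⟪v, y⟫`, which is centred with values in `[-M, M]`. Only norms
enter, so the dimension plays no role. -/
lemma integral_exp_inner_le {ν : Measure E} [IsProbabilityMeasure ν] {M : ℝ}
    (hb : ∀ᵐ y ∂ν, ‖y‖ ≤ M) (h0 : ∫ y, y ∂ν = 0) {v : E} (hv : ‖v‖ ≤ 1) :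
    ∫ y, Real.exp ⟪v, y⟫ ∂ν ≤ Real.exp (M ^ 2 / 2) := by
  have hM : 0 ≤ M := by
    obtain ⟨y, hy⟩ := hb.exists
    exact (norm_nonneg y).trans hy
  have hi : Integrable (fun y : E => y) ν :=
    Integrable.of_bound (by fun_prop) M hb
  have hs := hasSubgaussianMGF_of_mem_Icc_of_integral_eq_zero (μ := ν) (X := fun y : E => ⟪v, y⟫)
    (a := -M) (b := M) (by fun_prop) (by
      filter_upwards [hb] with y hy
      have := abs_real_inner_le_norm v y
      have : |⟪v, y⟫| ≤ M := this.trans (by nlinarith [norm_nonneg y, norm_nonneg v])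
      exact abs_le.1 this) (by
      rw [integral_inner hi, h0, inner_zero_right])
  have := hs.mgf_le 1
  simp only [mgf, one_mul] at this
  refine this.trans (Real.exp_le_exp.2 (le_of_eq ?_))
  simp only [NNReal.coe_pow, NNReal.coe_div, coe_nnnorm, Real.norm_eq_abs, NNReal.coe_ofNat]
  rw [abs_of_nonneg (by linarith)]
  ring

variable {Ω : Type*} [MeasurableSpace Ω] {P : Measure Ω} [IsProbabilityMeasure P]

/-- Induction on the summands. With the earlier sum frozen, a new term costs `exp (M²/2)` for the
quadratic part of the expansion and `exp (M²/2)` for the exponential moment of its centred linear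
part. The empty sum contributes `exp √1`, the source of the `1` in the exponent. -/
lemma integral_exp_sqrt_le {ι : Type*} {X : ι → Ω → E} {M : ℝ} (hX : ∀ i, Measurable (X i))
    (hind : iIndepFun X P) (hb : ∀ i, ∀ᵐ ω ∂P, ‖X i ω‖ ≤ M) (h0 : ∀ i, ∫ ω, X i ω ∂P = 0)
    (s : Finset ι) :
    ∫ ω, Real.exp (√(1 + ‖∑ i ∈ s, X i ω‖ ^ 2)) ∂P ≤ Real.exp (1 + s.card * M ^ 2) := by
  classical
  induction s using Finset.induction_on with
  | empty => simp
  | insert a s ha ih =>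
    set Y : Ω → E := fun ω => ∑ i ∈ s, X i ω with hY
    have hYm : Measurable Y := by fun_prop
    have hYb : ∀ᵐ ω ∂P, ‖Y ω‖ ≤ s.card * M := by
      filter_upwards [(ae_ball_iff (s : Set ι).toFinite.countable).2 fun i (_ : i ∈ (s : Set ι)) => hb i] with ω hω
      refine (norm_sum_le _ _).trans ((Finset.sum_le_sum fun i hi => hω i hi).trans ?_)
      simp
    have hI : IndepFun Y (X a) P := by
      have := hind.indepFun_finsetSum_of_notMem hX ha
      convert this using 1
      ext ω
      simp [hY]
    have hmap := (indepFun_iff_map_prod_eq_prod_map_map hYm.aemeasurable (hX a).aemeasurable).1 hI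
    set F : E → ℝ := fun u => Real.exp (√(1 + ‖u‖ ^ 2)) with hF
    set G : E × E → ℝ := fun q => F q.1 * (Real.exp (M ^ 2 / 2) *
      Real.exp ⟪(√(1 + ‖q.1‖ ^ 2))⁻¹ • q.1, q.2⟫) with hG
    have hFm : Measurable F := by fun_prop
    have hGm : Measurable G := by
      have : Measurable fun q : E × E => (√(1 + ‖q.1‖ ^ 2))⁻¹ • q.1 := by fun_prop
      fun_prop
    have hFb : ∀ u : E, ∀ c, ‖u‖ ≤ c → ‖F u‖ ≤ Real.exp (√(1 + c ^ 2)) := by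
      intro u c huc
      rw [hF, Real.norm_of_nonneg (Real.exp_nonneg _)]
      gcongr
    have hFi : Integrable (fun ω => F (Y ω)) P := by
      refine Integrable.of_bound (by fun_prop) (Real.exp (√(1 + (s.card * M) ^ 2))) ?_
      filter_upwards [hYb] with ω hω using hFb _ _ hω
    have hFi' : Integrable (fun ω => F (Y ω + X a ω)) P := by
      refine Integrable.of_bound (by fun_prop) (Real.exp (√(1 + (s.card * M + M) ^ 2))) ?_
      filter_upwards [hYb, hb a] with ω hω hω'
      exact hFb _ _ ((norm_add_le _ _).trans (add_le_add hω hω'))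
    have hGi : Integrable (fun ω => G (Y ω, X a ω)) P := by
      refine Integrable.of_bound (hGm.comp (hYm.prodMk (hX a))).aestronglyMeasurable
        (Real.exp (√(1 + (s.card * M) ^ 2)) *
        (Real.exp (M ^ 2 / 2) * Real.exp M)) ?_
      filter_upwards [hYb, hb a] with ω hω hω'
      rw [hG, norm_mul, norm_mul, Real.norm_of_nonneg (Real.exp_nonneg (M ^ 2 / 2)),
        Real.norm_of_nonneg (Real.exp_nonneg ⟪_, _⟫)]
      have h2 : ⟪(√(1 + ‖Y ω‖ ^ 2))⁻¹ • Y ω, X a ω⟫ ≤ M := by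
        refine (real_inner_le_norm _ _).trans ?_
        nlinarith [norm_inv_sqrt_smul_le (Y ω), norm_nonneg (X a ω),
          norm_nonneg ((√(1 + ‖Y ω‖ ^ 2))⁻¹ • Y ω)]
      have h1 := hFb _ _ hω
      dsimp only
      gcongr
    have hGi' : Integrable G ((P.map Y).prod (P.map (X a))) := by
      rw [← hmap]
      exact (integrable_map_measure (by fun_prop) (by fun_prop)).2 hGi
    have hν : IsProbabilityMeasure (P.map (X a)) := Measure.isProbabilityMeasure_map (by fun_prop)
    have hμ : IsProbabilityMeasure (P.map Y) := Measure.isProbabilityMeasure_map (by fun_prop)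
    have hbν : ∀ᵐ y ∂(P.map (X a)), ‖y‖ ≤ M :=
      (ae_map_iff (by fun_prop) (measurableSet_le (by fun_prop) (by fun_prop))).2 (hb a)
    have h0ν : ∫ y, y ∂(P.map (X a)) = 0 := by
      rw [integral_map (by fun_prop) (by fun_prop)]
      exact h0 a
    calc ∫ ω, Real.exp (√(1 + ‖∑ i ∈ insert a s, X i ω‖ ^ 2)) ∂P
        = ∫ ω, F (Y ω + X a ω) ∂P := by
          simp only [Finset.sum_insert ha, hF, hY, add_comm]
      _ ≤ ∫ ω, G (Y ω, X a ω) ∂P := by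
          refine integral_mono_ae hFi' hGi ?_
          filter_upwards [hb a] with ω hω
          simp only [hF, hG]
          rw [← Real.exp_add, ← Real.exp_add, Real.exp_le_exp]
          refine (sqrt_one_add_norm_add_sq_le _ _).trans ?_
          have : ‖X a ω‖ ^ 2 ≤ M ^ 2 := by gcongr
          linarith
      _ = ∫ q, G q ∂((P.map Y).prod (P.map (X a))) := by
          rw [← hmap, integral_map (by fun_prop) (by fun_prop)]
      _ = ∫ u, ∫ y, G (u, y) ∂(P.map (X a)) ∂(P.map Y) := integral_prod _ hGi'
      _ ≤ ∫ u, F u * Real.exp (M ^ 2) ∂(P.map Y) := by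
          refine integral_mono hGi'.integral_prod_left ?_ fun u => ?_
          · refine Integrable.mul_const ?_ _
            exact (integrable_map_measure (by fun_prop) (by fun_prop)).2 hFi
          · simp only [hG]
            rw [integral_const_mul, integral_const_mul]
            refine mul_le_mul_of_nonneg_left ?_ (Real.exp_nonneg _)
            calc _ ≤ Real.exp (M ^ 2 / 2) * Real.exp (M ^ 2 / 2) := by
                  refine mul_le_mul_of_nonneg_left ?_ (Real.exp_nonneg _)
                  exact integral_exp_inner_le hbν h0ν (norm_inv_sqrt_smul_le u)
              _ = _ := by rw [← Real.exp_add]; ring_nf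
      _ = (∫ ω, F (Y ω) ∂P) * Real.exp (M ^ 2) := by
          rw [integral_mul_const, integral_map (by fun_prop) (by fun_prop)]
      _ ≤ Real.exp (1 + s.card * M ^ 2) * Real.exp (M ^ 2) :=
          mul_le_mul_of_nonneg_right ih (Real.exp_nonneg _)
      _ = _ := by
          rw [← Real.exp_add, Finset.card_insert_of_notMem ha]
          push_cast
          ring_nf

/-- Hoeffding's inequality for bounded centred independent vectors of a Hilbert space. -/
lemma measure_norm_sum_ge_le {ι : Type*} {X : ι → Ω → E} {M : ℝ} (hM : 0 < M)
    (hX : ∀ i, Measurable (X i)) (hind : iIndepFun X P) (hb : ∀ i, ∀ᵐ ω ∂P, ‖X i ω‖ ≤ M)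
    (h0 : ∀ i, ∫ ω, X i ω ∂P = 0) {s : Finset ι} (hs : s.Nonempty) {u : ℝ} (hu : 0 < u) :
    P.real {ω | u ≤ ‖∑ i ∈ s, X i ω‖} ≤
      Real.exp (1 - u ^ 2 / (4 * s.card * M ^ 2)) := by
  have hs' : (0 : ℝ) < s.card := by exact_mod_cast hs.card_pos
  -- The Markov exponent `1 + |s| l² M² - l u` is minimal at this `l`.
  set l : ℝ := u / (2 * s.card * M ^ 2) with hl
  have hl0 : 0 < l := by positivity
  have key := integral_exp_sqrt_le (P := P) (X := fun i ω => l • X i ω) (M := l * M)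
    (fun i => (hX i).const_smul l)
    (hind.comp (fun _ => fun v : E => l • v) (fun _ => by fun_prop))
    (fun i => by
      filter_upwards [hb i] with ω hω
      rw [norm_smul, Real.norm_of_nonneg hl0.le]
      gcongr)
    (fun i => by rw [integral_smul, h0 i, smul_zero]) s
  simp only [← Finset.smul_sum] at key
  have hmark := mul_meas_ge_le_integral_of_nonneg (μ := P)
    (f := fun ω => Real.exp (√(1 + ‖l • ∑ i ∈ s, X i ω‖ ^ 2)))
    (Filter.Eventually.of_forall fun ω => Real.exp_nonneg _) (by
      refine Integrable.of_bound (by fun_prop) (Real.exp (√(1 + (l * (s.card * M)) ^ 2))) ?_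
      filter_upwards [(ae_ball_iff (s : Set ι).toFinite.countable).2
        fun i (_ : i ∈ (s : Set ι)) => hb i] with ω hω
      rw [Real.norm_of_nonneg (Real.exp_nonneg _), norm_smul, Real.norm_of_nonneg hl0.le]
      have : ‖∑ i ∈ s, X i ω‖ ≤ s.card * M := by
        refine (norm_sum_le _ _).trans ((Finset.sum_le_sum fun i hi => hω i hi).trans ?_)
        simp
      gcongr) (Real.exp (l * u))
  have hsub : P.real {ω | u ≤ ‖∑ i ∈ s, X i ω‖} ≤
      P.real {ω | Real.exp (l * u) ≤ Real.exp (√(1 + ‖l • ∑ i ∈ s, X i ω‖ ^ 2))} := by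
    refine measureReal_mono fun ω hω => ?_
    simp only [Set.mem_ofPred_eq] at hω ⊢
    rw [Real.exp_le_exp]
    refine Real.le_sqrt_of_sq_le ?_
    rw [norm_smul, Real.norm_of_nonneg hl0.le]
    have : (l * u) ^ 2 ≤ (l * ‖∑ i ∈ s, X i ω‖) ^ 2 := by gcongr
    linarith
  have : Real.exp (l * u) * P.real {ω | u ≤ ‖∑ i ∈ s, X i ω‖} ≤
      Real.exp (1 + s.card * (l * M) ^ 2) :=
    (mul_le_mul_of_nonneg_left hsub (Real.exp_nonneg _)).trans (hmark.trans key)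
  rw [← le_div_iff₀' (Real.exp_pos _), ← Real.exp_sub] at this
  refine this.trans (le_of_eq ?_)
  congr 1
  rw [hl]
  field_simp
  ring

end Hoeffding

/-! ### Concentration of sample means -/

section Concentration

variable {E : Type*} [NormedAddCommGroup E] [InnerProductSpace ℝ E] [MeasurableSpace E]
  [BorelSpace E] [FiniteDimensional ℝ E]
  {Ω : Type*} [MeasurableSpace Ω] {P : Measure Ω} [IsProbabilityMeasure P]

/-- The mean of `F` over the points `x i`, `i ∈ T`. -/
def smean {V ι : Type*} (x : ι → V) (T : Finset ι) (F : V → E) : E :=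
  (T.card : ℝ)⁻¹ • ∑ i ∈ T, F (x i)

lemma measure_smean_sub_ge_le {V ι : Type*} [MeasurableSpace V] {ρ : Measure V}
    [IsProbabilityMeasure ρ] {x : ι → Ω → V} (hx : ∀ i, Measurable (x i))
    (hlaw : ∀ i, HasLaw (x i) ρ P) (hind : iIndepFun x P) {F : V → E} (hF : Measurable F)
    {M : ℝ} (hM : 0 < M) (hb : ∀ᵐ v ∂ρ, ‖F v‖ ≤ M) {T : Finset ι} (hT : T.Nonempty)
    {ε : ℝ} (hε : 0 < ε) :
    P.real {ω | ε ≤ ‖smean (fun i => x i ω) T F - ∫ v, F v ∂ρ‖} ≤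
      Real.exp (1 - T.card * ε ^ 2 / (16 * M ^ 2)) := by
  have hT' : (0 : ℝ) < T.card := by exact_mod_cast hT.card_pos
  have hFi : Integrable F ρ := Integrable.of_bound (by fun_prop) M hb
  have hmean : ‖∫ v, F v ∂ρ‖ ≤ M := by
    have := norm_integral_le_of_norm_le_const hb
    simpa using this
  have hbi : ∀ i, ∀ᵐ ω ∂P, ‖F (x i ω)‖ ≤ M := fun i => by
    have h := hb
    rw [← (hlaw i).map_eq] at h
    exact ae_of_ae_map (hx i).aemeasurable h
  -- Centring doubles the bound on the norm, hence `16 M² = 4 (2M)²`.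
  have key := measure_norm_sum_ge_le (P := P) (X := fun i ω => F (x i ω) - ∫ v, F v ∂ρ)
    (M := 2 * M) (by positivity) (fun i => by have := hx i; fun_prop)
    (hind.comp (fun _ v => F v - ∫ v, F v ∂ρ) (fun _ => by fun_prop))
    (fun i => by
      filter_upwards [hbi i] with ω hω
      exact (norm_sub_le _ _).trans (by linarith))
    (fun i => by
      have h1 : Integrable (fun ω => F (x i ω)) P :=
        Integrable.of_bound (hF.comp (hx i)).aestronglyMeasurable M (hbi i)
      rw [integral_sub h1 (integrable_const _)]
      have := (hlaw i).integral_comp (f := F) (by fun_prop)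
      simp only [Function.comp_apply] at this
      rw [this]
      simp) hT (u := T.card * ε) (by positivity)
  refine (le_of_eq ?_).trans (key.trans (le_of_eq ?_))
  · congr 1
    ext ω
    simp only [Set.mem_ofPred_eq]
    rw [Finset.sum_sub_distrib, Finset.sum_const, ← Nat.cast_smul_eq_nsmul ℝ]
    have : ∑ i ∈ T, F (x i ω) - (T.card : ℝ) • ∫ v, F v ∂ρ =
        (T.card : ℝ) • (smean (fun i => x i ω) T F - ∫ v, F v ∂ρ) := by
      rw [smean, smul_sub, smul_smul, mul_inv_cancel₀ hT'.ne', one_smul]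
    rw [this, norm_smul, Real.norm_of_nonneg hT'.le, mul_le_mul_iff_right₀ hT']
  · congr 2
    field_simp
    ring

/-- On `S = T` the sub-sample is a fixed index set, and independence from the covariates lets the
bound for fixed sets apply. Sets `T` of size other than `s` have probability zero, and the weights
`P(S = T)` add up to one. -/
lemma measure_smean_subsample_ge_le {V : Type*} [MeasurableSpace V] {n s : ℕ} {ρ : Measure V}
    [IsProbabilityMeasure ρ] {x : Fin n → Ω → V} (hx : ∀ i, Measurable (x i))
    (hlaw : ∀ i, HasLaw (x i) ρ P) (hind : iIndepFun x P) {S : Ω → Finset (Fin n)}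
    (hS : IsUniformSubsample s S P) (hSx : IndepFun S (fun ω i => x i ω) P) (hs : 0 < s)
    {F : V → E} (hF : Measurable F) {M : ℝ} (hM : 0 < M) (hb : ∀ᵐ v ∂ρ, ‖F v‖ ≤ M)
    {ε : ℝ} (hε : 0 < ε) :
    P.real {ω | ε ≤ ‖smean (fun i => x i ω) (S ω) F - ∫ v, F v ∂ρ‖} ≤
      Real.exp (1 - s * ε ^ 2 / (16 * M ^ 2)) := by
  classical
  set A : Finset (Fin n) → Set (Fin n → V) :=
    fun T => {z | ε ≤ ‖smean z T F - ∫ v, F v ∂ρ‖} with hA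
  have hAm : ∀ T, MeasurableSet (A T) := fun T => by
    refine measurableSet_le measurable_const ?_
    unfold smean
    fun_prop
  have hsub : {ω | ε ≤ ‖smean (fun i => x i ω) (S ω) F - ∫ v, F v ∂ρ‖} ⊆
      ⋃ T ∈ (Finset.univ : Finset (Finset (Fin n))),
        (S ⁻¹' {T} ∩ (fun ω i => x i ω) ⁻¹' A T) := by
    intro ω hω
    simp only [Set.mem_iUnion]
    exact ⟨S ω, Finset.mem_univ _, rfl, hω⟩
  have hterm : ∀ T : Finset (Fin n), P.real (S ⁻¹' {T} ∩ (fun ω i => x i ω) ⁻¹' A T) ≤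
      P.real (S ⁻¹' {T}) * Real.exp (1 - s * ε ^ 2 / (16 * M ^ 2)) := by
    intro T
    have h1 := hSx.measure_inter_preimage_eq_mul {T} (A T) (measurableSet_singleton T) (hAm T)
    have h2 : P.real (S ⁻¹' {T} ∩ (fun ω i => x i ω) ⁻¹' A T) =
        P.real (S ⁻¹' {T}) * P.real ((fun ω i => x i ω) ⁻¹' A T) := by
      simp only [Measure.real, h1, ENNReal.toReal_mul]
    rw [h2]
    by_cases hTs : T.card = s
    · refine mul_le_mul_of_nonneg_left ?_ measureReal_nonneg
      have := measure_smean_sub_ge_le hx hlaw hind hF hM hb (T := T)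
        (Finset.card_pos.1 (by omega)) hε
      rw [hTs] at this
      exact this
    · have : P.real (S ⁻¹' {T}) = 0 := by simp [Measure.real, hS.2 T, hTs]
      simp [this]
  have htot : ∑ T : Finset (Fin n), P.real (S ⁻¹' {T}) = 1 := by
    have h := sum_measureReal_preimage_singleton (μ := P) (f := S) Finset.univ
      (fun T _ => hS.1 (measurableSet_singleton T))
    simp at h
    exact h
  calc _ ≤ _ := measureReal_mono hsub (measure_ne_top _ _)
    _ ≤ ∑ T ∈ (Finset.univ : Finset (Finset (Fin n))), _ := measureReal_biUnion_finset_le _ _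
    _ ≤ ∑ T : Finset (Fin n),
        P.real (S ⁻¹' {T}) * Real.exp (1 - s * ε ^ 2 / (16 * M ^ 2)) :=
      Finset.sum_le_sum fun T _ => hterm T
    _ = _ := by rw [← Finset.sum_mul, htot, one_mul]

/-- The point of the grid `n⁻¹ ℤ^p` with the integer coordinates `k`. -/
def gridPoint {p : ℕ} (n : ℕ) (k : Fin p → ℤ) : Vec p :=
  WithLp.toLp 2 fun j => (k j : ℝ) / n

lemma exists_gridPoint_near {p n : ℕ} (hp : 0 < p) (hn : 0 < n) {R : ℝ} {β : Vec p}
    (hβ : ‖β‖ ≤ R) :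
    ∃ k ∈ Fintype.piFinset fun _ : Fin p => Finset.Icc (-⌈n * R⌉) ⌈n * R⌉,
      ‖β - gridPoint n k‖ ≤ p / n := by
  have hn' : (0 : ℝ) < n := by exact_mod_cast hn
  refine ⟨fun j => ⌊n * β j⌋, ?_, ?_⟩
  · rw [Fintype.mem_piFinset]
    intro j
    have h1 : |β j| ≤ R := by
      have := PiLp.norm_apply_le β j
      rw [Real.norm_eq_abs] at this
      exact this.trans hβ
    obtain ⟨h2, h3⟩ := abs_le.1 h1
    rw [Finset.mem_Icc]
    constructor
    · rw [← Int.floor_neg]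
      exact Int.floor_mono (by nlinarith)
    · exact (Int.floor_le_ceil _).trans (Int.ceil_mono (by nlinarith))
  · rw [EuclideanSpace.norm_eq]
    refine Real.sqrt_le_iff.2 ⟨by positivity, ?_⟩
    calc ∑ j, ‖(β - gridPoint n fun j => ⌊n * β j⌋) j‖ ^ 2 ≤ ∑ j : Fin p, (1 / (n : ℝ)) ^ 2 := by
          refine Finset.sum_le_sum fun j _ => ?_
          have h : ‖(β - gridPoint n fun j => ⌊n * β j⌋) j‖ ≤ 1 / n := by
            have h1 := Int.floor_le (n * β j)
            have h2 := Int.lt_floor_add_one (n * β j)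
            have : (β - gridPoint n fun j => ⌊n * β j⌋) j = (n * β j - ⌊n * β j⌋) / n := by
              simp only [gridPoint, PiLp.sub_apply]
              field_simp
            rw [this, Real.norm_eq_abs, abs_of_nonneg (div_nonneg (by linarith) hn'.le)]
            gcongr
            linarith
          gcongr
      _ = p * (1 / (n : ℝ)) ^ 2 := by simp
      _ ≤ (p / n : ℝ) ^ 2 := by
          have : (1 : ℝ) ≤ p := by exact_mod_cast hp
          rw [div_pow, div_pow, one_pow, mul_one_div]
          gcongr
          nlinarith

/-- Moving `β` to a grid point within `p / n` changes the sample mean and the expectation by at most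
`L p / n` each; a union bound over the grid does the rest. Grid points may leave the ball, so the
bounds on `F` are required for every `β`. -/
lemma measure_smean_uniform_le {p n : ℕ} (hp : 0 < p) (hn : 0 < n) {ρ : Measure (Vec p)}
    [IsProbabilityMeasure ρ] {x : Fin n → Ω → Vec p} (hx : ∀ i, Measurable (x i))
    (hlaw : ∀ i, HasLaw (x i) ρ P) (hind : iIndepFun x P) {K : ℝ} (hK : ∀ᵐ v ∂ρ, ‖v‖ ≤ √K)
    {F : Vec p → Vec p → E} (hF : ∀ β, Measurable (F β)) {M L R ε : ℝ} (hM : 0 < M) (hR : 0 < R)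
    (hb : ∀ β v, ‖v‖ ≤ √K → ‖F β v‖ ≤ M) (hL0 : 0 ≤ L)
    (hL : ∀ β β' v, ‖v‖ ≤ √K → ‖F β v - F β' v‖ ≤ L * ‖β - β'‖) (hε : 0 < ε) :
    P.real {ω | ∃ β, ‖β‖ ≤ R ∧ ε + 2 * (L * (p / n)) <
        ‖smean (fun i => x i ω) Finset.univ (F β) - ∫ v, F β v ∂ρ‖} ≤
      (2 * ⌈n * R⌉₊ + 1 : ℝ) ^ p * Real.exp (1 - n * ε ^ 2 / (16 * M ^ 2)) := by
  classical
  have hn' : (0 : ℝ) < n := by exact_mod_cast hn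
  have hFi : ∀ β, Integrable (F β) ρ := fun β =>
    Integrable.of_bound (hF β).aestronglyMeasurable M (by
      filter_upwards [hK] with v hv using hb β v hv)
  set G := Fintype.piFinset fun _ : Fin p => Finset.Icc (-⌈n * R⌉) ⌈n * R⌉ with hG
  have hcard : (G.card : ℝ) = (2 * ⌈n * R⌉₊ + 1 : ℝ) ^ p := by
    have h0 : ⌈n * R⌉ = (⌈n * R⌉₊ : ℤ) := (Int.natCast_ceil_eq_ceil (by positivity)).symm
    rw [hG, Fintype.card_piFinset_const, Int.card_Icc, h0]
    have : ((⌈n * R⌉₊ : ℤ) + 1 - -(⌈n * R⌉₊ : ℤ)).toNat = 2 * ⌈n * R⌉₊ + 1 := by omega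
    rw [this]
    simp
  have hxK : ∀ᵐ ω ∂P, ∀ i, ‖x i ω‖ ≤ √K := by
    rw [ae_all_iff]
    intro i
    have h := hK
    rw [← (hlaw i).map_eq] at h
    exact ae_of_ae_map (hx i).aemeasurable h
  have hsub : {ω | ∃ β, ‖β‖ ≤ R ∧ ε + 2 * (L * (p / n)) <
        ‖smean (fun i => x i ω) Finset.univ (F β) - ∫ v, F β v ∂ρ‖} ≤ᵐ[P]
      ⋃ k ∈ G, {ω | ε ≤ ‖smean (fun i => x i ω) Finset.univ (F (gridPoint n k)) -
        ∫ v, F (gridPoint n k) v ∂ρ‖} := by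
    filter_upwards [hxK] with ω hω hmem
    obtain ⟨β, hβ, hlt⟩ := hmem
    obtain ⟨k, hk, hkβ⟩ := exists_gridPoint_near hp hn hβ
    refine Set.mem_iUnion₂.2 ⟨k, hk, ?_⟩
    set g := gridPoint n k with hg
    have hLg : ∀ v : Vec p, ‖v‖ ≤ √K → ‖F β v - F g v‖ ≤ L * (p / n) := fun v hv =>
      (hL β g v hv).trans (by gcongr)
    have h1 : ‖smean (fun i => x i ω) Finset.univ (F β) -
        smean (fun i => x i ω) Finset.univ (F g)‖ ≤ L * (p / n) := by
      simp only [smean]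
      rw [← smul_sub, ← Finset.sum_sub_distrib, norm_smul, norm_inv, Finset.card_univ,
        Fintype.card_fin, RCLike.norm_natCast, inv_mul_le_iff₀ hn']
      refine (norm_sum_le _ _).trans ((Finset.sum_le_sum fun i _ => hLg _ (hω i)).trans ?_)
      simp
    have h2 : ‖∫ v, F g v ∂ρ - ∫ v, F β v ∂ρ‖ ≤ L * (p / n) := by
      rw [← integral_sub (hFi _) (hFi _)]
      have := norm_integral_le_of_norm_le_const (μ := ρ) (f := fun v => F g v - F β v)
        (C := L * (p / n)) (by
          filter_upwards [hK] with v hv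
          rw [norm_sub_rev]
          exact hLg v hv)
      simpa using this
    have h3 : smean (fun i => x i ω) Finset.univ (F β) - ∫ v, F β v ∂ρ =
        (smean (fun i => x i ω) Finset.univ (F β) - smean (fun i => x i ω) Finset.univ (F g)) +
        (smean (fun i => x i ω) Finset.univ (F g) - ∫ v, F g v ∂ρ) +
        (∫ v, F g v ∂ρ - ∫ v, F β v ∂ρ) := by abel
    rw [h3] at hlt
    have h4 := norm_add₃_le (a := smean (fun i => x i ω) Finset.univ (F β) -
      smean (fun i => x i ω) Finset.univ (F g))
      (b := smean (fun i => x i ω) Finset.univ (F g) - ∫ v, F g v ∂ρ)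
      (c := ∫ v, F g v ∂ρ - ∫ v, F β v ∂ρ)
    simp only [Set.mem_ofPred_eq]
    linarith
  have : Nonempty (Fin n) := ⟨⟨0, hn⟩⟩
  calc _ ≤ P.real (⋃ k ∈ G, {ω | ε ≤ ‖smean (fun i => x i ω) Finset.univ (F (gridPoint n k)) -
        ∫ v, F (gridPoint n k) v ∂ρ‖}) :=
        ENNReal.toReal_mono (measure_ne_top _ _) (measure_mono_ae hsub)
    _ ≤ ∑ k ∈ G, _ := measureReal_biUnion_finset_le _ _
    _ ≤ ∑ k ∈ G, Real.exp (1 - n * ε ^ 2 / (16 * M ^ 2)) := by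
        refine Finset.sum_le_sum fun k _ => ?_
        have := measure_smean_sub_ge_le hx hlaw hind (hF (gridPoint n k)) hM (by
          filter_upwards [hK] with v hv using hb _ v hv) (T := Finset.univ)
          Finset.univ_nonempty hε
        simpa using this
    _ = _ := by rw [Finset.sum_const, nsmul_eq_mul, hcard]

end Concentration

/-! ### Stein's identity -/

section Stein

open scoped NNReal

lemma integrable_gaussianReal_iff {v : ℝ≥0} (hv : v ≠ 0) {g : ℝ → ℝ} :
    Integrable g (gaussianReal 0 v) ↔ Integrable fun u => g u * gaussianPDFReal 0 v u := by
  rw [gaussianReal_of_var_ne_zero _ hv, integrable_withDensity_iff_integrable_smul'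
    (measurable_gaussianPDF 0 v) (Filter.Eventually.of_forall fun _ => gaussianPDF_lt_top)]
  simp only [toReal_gaussianPDF, smul_eq_mul, mul_comm]

lemma hasDerivAt_gaussianPDFReal {v : ℝ≥0} (hv : v ≠ 0) (u : ℝ) :
    HasDerivAt (gaussianPDFReal 0 v) (-(u / v) * gaussianPDFReal 0 v u) u := by
  have hv' : (v : ℝ) ≠ 0 := by exact_mod_cast hv
  rw [gaussianPDFReal_def]
  have h1 : HasDerivAt (fun x : ℝ => -(x - 0) ^ 2 / (2 * v)) (-(u / v)) u := by
    have h : HasDerivAt (fun x : ℝ => -(x - 0) ^ 2 / (2 * v)) (-(2 * u) / (2 * v)) u := by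
      simpa using (((hasDerivAt_id' u).sub_const 0).fun_pow 2).fun_neg.div_const (2 * (v : ℝ))
    refine h.congr_deriv ?_
    field_simp
  refine (h1.exp.const_mul (√(2 * Real.pi * v))⁻¹).congr_deriv ?_
  ring

/-- Stein's identity in dimension one. -/
lemma integral_mul_gaussianReal {v : ℝ≥0} (hv : v ≠ 0) {g g' : ℝ → ℝ}
    (hg : ∀ u, HasDerivAt g (g' u) u) (h1 : Integrable g (gaussianReal 0 v))
    (h2 : Integrable g' (gaussianReal 0 v))
    (h3 : Integrable (fun u => u * g u) (gaussianReal 0 v)) :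
    ∫ u, u * g u ∂(gaussianReal 0 v) = v * ∫ u, g' u ∂(gaussianReal 0 v) := by
  have hv' : (v : ℝ) ≠ 0 := by exact_mod_cast hv
  rw [integrable_gaussianReal_iff hv] at h1 h2 h3
  have key := integral_mul_deriv_eq_deriv_mul_of_integrable (u := g) (v := gaussianPDFReal 0 v)
    (u' := g') (v' := fun u => -(u / v) * gaussianPDFReal 0 v u) (fun u _ => hg u)
    (fun u _ => hasDerivAt_gaussianPDFReal hv u) (by
      refine (h3.const_mul (-(v : ℝ)⁻¹)).congr (Filter.Eventually.of_forall fun u => ?_)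
      simp only [Pi.mul_apply]
      ring) h2 h1
  rw [integral_gaussianReal_eq_integral_smul hv, integral_gaussianReal_eq_integral_smul hv]
  simp only [smul_eq_mul]
  have e1 : ∫ u, gaussianPDFReal 0 v u * (u * g u) =
      -(v : ℝ) * ∫ u, g u * (-(u / v) * gaussianPDFReal 0 v u) := by
    rw [← integral_const_mul]
    congr 1
    ext u
    field_simp
  have e2 : ∫ u, gaussianPDFReal 0 v u * g' u = ∫ u, g' u * gaussianPDFReal 0 v u := by
    simp only [mul_comm]
  rw [e1, e2, key]
  ring

/-- Two integrations by parts: `𝔼[u · u f] = v 𝔼[f + u f']`, then `𝔼[u f'] = v 𝔼[f'']`. -/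
lemma integral_sq_mul_gaussianReal {v : ℝ≥0} (hv : v ≠ 0) {f f₁ f₂ : ℝ → ℝ}
    (hf : ∀ u, HasDerivAt f (f₁ u) u) (hf₁ : ∀ u, HasDerivAt f₁ (f₂ u) u) (hf₂ : Continuous f₂)
    {b b₁ b₂ : ℝ} (hb : ∀ u, |f u| ≤ b) (hb₁ : ∀ u, |f₁ u| ≤ b₁) (hb₂ : ∀ u, |f₂ u| ≤ b₂) :
    ∫ u, u ^ 2 * f u ∂(gaussianReal 0 v) =
      v * ∫ u, f u ∂(gaussianReal 0 v) + v ^ 2 * ∫ u, f₂ u ∂(gaussianReal 0 v) := by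
  have c0 : Continuous f := continuous_iff_continuousAt.2 fun u => (hf u).continuousAt
  have c1 : Continuous f₁ := continuous_iff_continuousAt.2 fun u => (hf₁ u).continuousAt
  have hid : MemLp (fun u : ℝ => u) 2 (gaussianReal 0 v) := memLp_id_gaussianReal' 2 (by norm_num)
  have i1 : Integrable (fun u : ℝ => u) (gaussianReal 0 v) := hid.integrable (by norm_num)
  have i2 : Integrable (fun u : ℝ => u ^ 2) (gaussianReal 0 v) := hid.integrable_sq
  have bdd : ∀ {h : ℝ → ℝ} {c : ℝ}, Continuous h → (∀ u, |h u| ≤ c) →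
      Integrable h (gaussianReal 0 v) := fun hc hb =>
    Integrable.of_bound hc.aestronglyMeasurable _ (Filter.Eventually.of_forall hb)
  have bmul : ∀ {h k : ℝ → ℝ} {c : ℝ}, Continuous h → (∀ u, |h u| ≤ c) →
      Integrable k (gaussianReal 0 v) → Integrable (fun u => k u * h u) (gaussianReal 0 v) :=
    fun hc hb hk => hk.mul_bdd hc.aestronglyMeasurable (Filter.Eventually.of_forall hb)
  have s1 := integral_mul_gaussianReal hv (g := f₁) hf₁ (bdd c1 hb₁) (bdd hf₂ hb₂)
    (bmul c1 hb₁ i1)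
  have hg : ∀ u, HasDerivAt (fun u => u * f u) (f u + u * f₁ u) u := fun u => by
    simpa using (hasDerivAt_id' u).fun_mul (hf u)
  have s2 := integral_mul_gaussianReal hv (g := fun u => u * f u) hg (bmul c0 hb i1)
    ((bdd c0 hb).add (bmul c1 hb₁ i1)) (by
      refine (bmul c0 hb i2).congr (Filter.Eventually.of_forall fun u => ?_)
      simp only
      ring)
  rw [integral_add (bdd c0 hb) (bmul c1 hb₁ i1), s1] at s2
  calc _ = ∫ u, u * (u * f u) ∂(gaussianReal 0 v) := by
        congr 1
        ext u
        ring
    _ = _ := by rw [s2]; ring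

variable {p : ℕ} {Sig : Matrix (Fin p) (Fin p) ℝ}

lemma memLp_inner_multivariateGaussian (w : Vec p) :
    MemLp (fun v => ⟪w, v⟫) 2 (multivariateGaussian 0 Sig) :=
  IsGaussian.memLp_two_id.const_inner w

lemma integral_inner_multivariateGaussian (w : Vec p) :
    ∫ v, ⟪w, v⟫ ∂(multivariateGaussian 0 Sig) = 0 := by
  rw [integral_inner IsGaussian.integrable_fun_id, integral_id_multivariateGaussian,
    inner_zero_right]

lemma integral_inner_mul_inner_multivariateGaussian (hS : Sig.PosSemidef) (a b : Vec p) :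
    ∫ v, ⟪a, v⟫ * ⟪b, v⟫ ∂(multivariateGaussian 0 Sig) = ⟪act Sig a, b⟫ := by
  have h1 := covarianceBilin_multivariateGaussian (μ := 0) hS b a
  rw [covarianceBilin_apply IsGaussian.memLp_two_id] at h1
  simp only [id_eq, integral_id_multivariateGaussian, sub_zero] at h1
  rw [act, real_inner_comm, inner_toEuclideanCLM, ← h1]
  simp only [mul_comm]

lemma cov_inner_multivariateGaussian (hS : Sig.PosSemidef) (a b : Vec p) :
    cov[fun v => ⟪a, v⟫, fun v => ⟪b, v⟫; multivariateGaussian 0 Sig] = ⟪act Sig a, b⟫ := by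
  rw [← integral_inner_mul_inner_multivariateGaussian hS]
  simp [covariance, integral_inner_multivariateGaussian]

lemma map_inner_multivariateGaussian (hS : Sig.PosSemidef) (β : Vec p) :
    (multivariateGaussian 0 Sig).map (fun v => ⟪β, v⟫) =
      gaussianReal 0 ⟪act Sig β, β⟫.toNNReal := by
  have h := IsGaussian.map_eq_gaussianReal (μ := multivariateGaussian 0 Sig) (innerSL ℝ β)
  have e : ⇑(innerSL ℝ β) = fun v => ⟪β, v⟫ := rfl
  rw [e] at h
  rw [h, integral_inner_multivariateGaussian, ← covariance_self (by fun_prop),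
    cov_inner_multivariateGaussian hS]

lemma indepFun_inner_multivariateGaussian (hS : Sig.PosSemidef) {a b : Vec p}
    (hab : ⟪act Sig a, b⟫ = 0) :
    IndepFun (fun v => ⟪a, v⟫) (fun v => ⟪b, v⟫) (multivariateGaussian 0 Sig) := by
  refine HasGaussianLaw.indepFun_of_covariance_eq_zero ?_ ?_
  · exact (IsGaussian.hasGaussianLaw_id (μ := multivariateGaussian 0 Sig)).map_of_measurable
      ((innerSL ℝ a).prod (innerSL ℝ b)) (by fun_prop)
  · rw [cov_inner_multivariateGaussian hS, hab]

/-- Stein's identity for the second moments of a Gaussian vector. -/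
lemma integral_sq_inner_mul_multivariateGaussian (hS : Sig.PosSemidef) {f f₁ f₂ : ℝ → ℝ}
    (hf : ∀ u, HasDerivAt f (f₁ u) u) (hf₁ : ∀ u, HasDerivAt f₁ (f₂ u) u) (hf₂ : Continuous f₂)
    {b b₁ b₂ : ℝ} (hb : ∀ u, |f u| ≤ b) (hb₁ : ∀ u, |f₁ u| ≤ b₁) (hb₂ : ∀ u, |f₂ u| ≤ b₂)
    (β w : Vec p) (hβ : β ≠ 0 → 0 < ⟪act Sig β, β⟫) :
    ∫ v, ⟪w, v⟫ ^ 2 * f ⟪v, β⟫ ∂(multivariateGaussian 0 Sig) =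
      (∫ v, f ⟪v, β⟫ ∂(multivariateGaussian 0 Sig)) * ⟪act Sig w, w⟫ +
      (∫ v, f₂ ⟪v, β⟫ ∂(multivariateGaussian 0 Sig)) * ⟪act Sig β, w⟫ ^ 2 := by
  have c0 : Continuous f := continuous_iff_continuousAt.2 fun u => (hf u).continuousAt
  set γ := multivariateGaussian 0 Sig with hγ
  have sqw : ∀ w : Vec p, ∫ v, ⟪w, v⟫ ^ 2 ∂γ = ⟪act Sig w, w⟫ := fun w => by
    rw [← integral_inner_mul_inner_multivariateGaussian hS]
    simp only [sq, hγ]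
  rcases eq_or_ne β 0 with rfl | hβ0
  · simp only [inner_zero_right, integral_mul_const, sqw, act, map_zero, inner_zero_left]
    simp [mul_comm]
  have hpos := hβ hβ0
  set V := ⟪act Sig β, β⟫ with hV
  set a := ⟪act Sig β, w⟫ / V with ha
  -- `g` is the part of `w` that is `Σ`-orthogonal to `β`. Thus `⟪g, v⟫` is uncorrelated with `⟪β,
  -- v⟫`, hence independent of it, and the square splits into a one-dimensional Stein term, a
  -- vanishing cross term and a product of expectations.
  set g := w - a • β with hg
  have hβg : ⟪act Sig β, g⟫ = 0 := by
    rw [hg, inner_sub_right, inner_smul_right, ← hV, ha]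
    field_simp
    simp
  have hind := indepFun_inner_multivariateGaussian hS hβg
  rw [← hγ] at hind
  have hsymm : ∀ x y : Vec p, ⟪act Sig x, y⟫ = ⟪act Sig y, x⟫ := fun x y => by
    rw [← integral_inner_mul_inner_multivariateGaussian hS,
      ← integral_inner_mul_inner_multivariateGaussian hS]
    simp only [mul_comm]
  have hgg : ⟪act Sig g, g⟫ = ⟪act Sig w, w⟫ - a ^ 2 * V := by
    have h1 : ⟪act Sig g, g⟫ = ⟪act Sig g, w⟫ := by
      conv_lhs => rw [hg]
      rw [inner_sub_right, inner_smul_right, ← hg, hsymm g β, hβg]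
      simp
    rw [h1, hsymm g w, hg, inner_sub_right, inner_smul_right, hsymm w β, ha]
    field_simp
  have hU := memLp_inner_multivariateGaussian (Sig := Sig) β
  have hG := memLp_inner_multivariateGaussian (Sig := Sig) g
  rw [← hγ] at hU hG
  have bmul : ∀ {k : Vec p → ℝ}, Integrable k γ → Integrable (fun v => k v * f ⟪β, v⟫) γ :=
    fun hk => hk.mul_bdd (c := b) (by fun_prop) (Filter.Eventually.of_forall fun v => hb _)
  have hNN : ⟪act Sig β, β⟫.toNNReal ≠ 0 := by
    rw [← hV]
    exact (Real.toNNReal_pos.2 hpos).ne'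
  have hmapU : ∀ h : ℝ → ℝ, Continuous h → ∫ v, h ⟪β, v⟫ ∂γ =
      ∫ u, h u ∂(gaussianReal 0 ⟪act Sig β, β⟫.toNNReal) := fun h hh => by
    rw [← map_inner_multivariateGaussian hS, integral_map (by fun_prop) (by fun_prop)]
  have stein : ∫ v, ⟪β, v⟫ ^ 2 * f ⟪β, v⟫ ∂γ =
      V * ∫ v, f ⟪β, v⟫ ∂γ + V ^ 2 * ∫ v, f₂ ⟪β, v⟫ ∂γ := by
    rw [hmapU (fun u => u ^ 2 * f u) (by fun_prop), hmapU f c0, hmapU f₂ hf₂,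
      integral_sq_mul_gaussianReal hNN hf hf₁ hf₂ hb hb₁ hb₂, Real.coe_toNNReal _ hpos.le]
  have cross : ∫ v, (⟪β, v⟫ * ⟪g, v⟫) * f ⟪β, v⟫ ∂γ = 0 := by
    have h := (hind.comp (φ := fun u => u * f u) (ψ := id) (by fun_prop)
      measurable_id).integral_fun_mul_eq_mul_integral (by fun_prop) (by fun_prop)
    simp only [Function.comp_def, id] at h
    have h0 : ∫ v, ⟪g, v⟫ ∂γ = 0 := integral_inner_multivariateGaussian g
    rw [h0, mul_zero] at h
    rw [← h]
    congr 1
    ext v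
    ring
  have square : ∫ v, ⟪g, v⟫ ^ 2 * f ⟪β, v⟫ ∂γ = ⟪act Sig g, g⟫ * ∫ v, f ⟪β, v⟫ ∂γ := by
    have h := (hind.comp (φ := f) (ψ := fun u => u ^ 2) (by fun_prop)
      (by fun_prop)).integral_fun_mul_eq_mul_integral (by fun_prop) (by fun_prop)
    simp only [Function.comp_def] at h
    rw [sqw] at h
    simp only [mul_comm (⟪g, _⟫ ^ 2)]
    rw [h, mul_comm]
  have expand : ∀ v : Vec p, ⟪w, v⟫ ^ 2 * f ⟪v, β⟫ =
      a ^ 2 * (⟪β, v⟫ ^ 2 * f ⟪β, v⟫) + 2 * a * ((⟪β, v⟫ * ⟪g, v⟫) * f ⟪β, v⟫) +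
        ⟪g, v⟫ ^ 2 * f ⟪β, v⟫ := fun v => by
    have : ⟪w, v⟫ = a * ⟪β, v⟫ + ⟪g, v⟫ := by
      rw [hg, inner_sub_left, real_inner_smul_left]
      ring
    rw [this, real_inner_comm β v]
    ring
  have i1 := bmul hU.integrable_sq
  have i2 := bmul (hU.integrable_mul hG)
  have i3 := bmul hG.integrable_sq
  simp only [Pi.mul_apply] at i2
  simp only [expand]
  have e1 := integral_add ((i1.const_mul (a ^ 2)).add (i2.const_mul (2 * a))) i3
  have e2 := integral_add (i1.const_mul (a ^ 2)) (i2.const_mul (2 * a))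
  simp only [Pi.add_apply] at e1
  rw [e1, e2, integral_const_mul, integral_const_mul,
    stein, cross, square, hgg]
  simp only [real_inner_comm β]
  rw [ha]
  field_simp
  ring

end Stein

/-! ### Matrices acting on vectors -/

section LinearAlgebra

variable {p : ℕ} {A : Matrix (Fin p) (Fin p) ℝ}

lemma act_add_left (A B : Matrix (Fin p) (Fin p) ℝ) (v : Vec p) :
    act (A + B) v = act A v + act B v := by simp [act]

lemma act_sub_left (A B : Matrix (Fin p) (Fin p) ℝ) (v : Vec p) :
    act (A - B) v = act A v - act B v := by simp [act]

lemma act_smul_left (c : ℝ) (A : Matrix (Fin p) (Fin p) ℝ) (v : Vec p) :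
    act (c • A) v = c • act A v := by simp [act]

lemma act_one (v : Vec p) : act 1 v = v := by simp [act]

lemma act_add_right (A : Matrix (Fin p) (Fin p) ℝ) (v w : Vec p) :
    act A (v + w) = act A v + act A w := by simp [act]

lemma act_sub_right (A : Matrix (Fin p) (Fin p) ℝ) (v w : Vec p) :
    act A (v - w) = act A v - act A w := by simp [act]

lemma act_smul_right (A : Matrix (Fin p) (Fin p) ℝ) (c : ℝ) (v : Vec p) :
    act A (c • v) = c • act A v := by simp [act]

lemma act_mul (A B : Matrix (Fin p) (Fin p) ℝ) (v : Vec p) : act (A * B) v = act A (act B v) := by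
  simp [act]

lemma act_sum_left {ι : Type*} (s : Finset ι) (A : ι → Matrix (Fin p) (Fin p) ℝ) (v : Vec p) :
    act (∑ i ∈ s, A i) v = ∑ i ∈ s, act (A i) v := by
  simp [act, map_sum]

lemma act_outer (u v : Vec p) : act (outer u) v = ⟪u, v⟫ • u := by
  ext j
  simp only [act, ofLp_toEuclideanCLM, outer, mulVec, dotProduct, Matrix.of_apply,
    PiLp.smul_apply, PiLp.inner_apply, RCLike.inner_apply, conj_trivial, smul_eq_mul,
    Finset.sum_mul]
  refine Finset.sum_congr rfl fun k _ => ?_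
  ring

lemma inner_act_comm (hA : A.IsHermitian) (v w : Vec p) : ⟪act A v, w⟫ = ⟪v, act A w⟫ := by
  have h : IsSelfAdjoint (Matrix.toEuclideanCLM (𝕜 := ℝ) A) :=
    IsSelfAdjoint.map (hx := hA) (f := Matrix.toEuclideanCLM (𝕜 := ℝ))
  exact h.isSymmetric v w

/-- The quadratic form of a symmetric operator controls its norm. -/
lemma norm_act_le_of_abs_inner_le (hA : A.IsHermitian) {c : ℝ}
    (h : ∀ w, |⟪act A w, w⟫| ≤ c * ‖w‖ ^ 2) (v : Vec p) : ‖act A v‖ ≤ c * ‖v‖ := by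
  rcases eq_or_ne v 0 with rfl | hv
  · simp [act]
  have hv' : 0 < ‖v‖ := norm_pos_iff.2 hv
  rcases eq_or_ne (act A v) 0 with h0 | h0
  · have := (abs_nonneg _).trans (h v)
    rw [h0, norm_zero]
    have hc : 0 ≤ c := nonneg_of_mul_nonneg_left this (by positivity)
    positivity
  have hA' : 0 < ‖act A v‖ := norm_pos_iff.2 h0
  -- This is `act A v` rescaled to the length of `v`. With equal lengths, polarization and the
  -- parallelogram law return the constant `c` without loss.
  set y := (‖v‖ / ‖act A v‖) • act A v with hy
  have hyn : ‖y‖ = ‖v‖ := by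
    rw [hy, norm_smul, Real.norm_of_nonneg (by positivity)]
    field_simp
  have hin : ⟪act A v, y⟫ = ‖v‖ * ‖act A v‖ := by
    rw [hy, inner_smul_right, real_inner_self_eq_norm_sq]
    field_simp
  have hpol : 4 * ⟪act A v, y⟫ = ⟪act A (v + y), v + y⟫ - ⟪act A (v - y), v - y⟫ := by
    rw [act_add_right, act_sub_right]
    simp only [inner_add_left, inner_add_right, inner_sub_left, inner_sub_right]
    have := inner_act_comm hA y v
    rw [real_inner_comm] at this
    linarith [real_inner_comm v (act A y), real_inner_comm y (act A v)]
  have h1 := (abs_le.1 (h (v + y))).2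
  have h2 := (abs_le.1 (h (v - y))).1
  have h3 := parallelogram_law_with_norm ℝ v y
  rw [hyn] at h3
  have : ‖v‖ * ‖act A v‖ ≤ ‖v‖ * (c * ‖v‖) := by
    have : c * (‖v + y‖ ^ 2 + ‖v - y‖ ^ 2) = c * (2 * (‖v‖ ^ 2 + ‖v‖ ^ 2)) := by
      rw [h3]
    nlinarith
  exact le_of_mul_le_mul_left this hv'

lemma abs_inner_act_le_of_abs_inner_le (hA : A.IsHermitian) {c : ℝ}
    (h : ∀ w, |⟪act A w, w⟫| ≤ c * ‖w‖ ^ 2) (v w : Vec p) : |⟪act A v, w⟫| ≤ c * ‖v‖ * ‖w‖ :=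
  (abs_real_inner_le_norm _ _).trans
    (mul_le_mul_of_nonneg_right (norm_act_le_of_abs_inner_le hA h v) (norm_nonneg w))

lemma isUnit_det_of_inner_act_ge {c : ℝ} (hc : 0 < c) (h : ∀ w, c * ‖w‖ ^ 2 ≤ ⟪act A w, w⟫) :
    IsUnit A.det := by
  rw [← Matrix.isUnit_iff_isUnit_det, ← Matrix.mulVec_injective_iff_isUnit]
  have key : ∀ w : Vec p, act A w = 0 → w = 0 := fun w hw => by
    have := h w
    rw [hw, inner_zero_left] at this
    have h2 : ‖w‖ ^ 2 ≤ 0 := by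
      by_contra! hneg
      nlinarith
    have h3 : ‖w‖ = 0 := by
      have := sq_nonneg ‖w‖
      exact pow_eq_zero_iff (two_ne_zero) |>.1 (le_antisymm h2 this)
    exact norm_eq_zero.1 h3
  intro v w hvw
  have := key (WithLp.toLp 2 (v - w)) (by
    ext j
    simp only [act, ofLp_toEuclideanCLM, mulVec_sub, PiLp.zero_apply]
    simp [hvw])
  have h2 : v - w = 0 := congrArg WithLp.ofLp this
  exact sub_eq_zero.1 h2

lemma act_inv_act (h : IsUnit A.det) (v : Vec p) : act A⁻¹ (act A v) = v := by
  rw [← act_mul, Matrix.nonsing_inv_mul _ h, act_one]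

lemma act_act_inv (h : IsUnit A.det) (v : Vec p) : act A (act A⁻¹ v) = v := by
  rw [← act_mul, Matrix.mul_nonsing_inv _ h, act_one]

lemma norm_act_inv_le {c : ℝ} (hc : 0 < c) (h : ∀ w, c * ‖w‖ ^ 2 ≤ ⟪act A w, w⟫) (v : Vec p) :
    ‖act A⁻¹ v‖ ≤ c⁻¹ * ‖v‖ := by
  have h1 := h (act A⁻¹ v)
  rw [act_act_inv (isUnit_det_of_inner_act_ge hc h)] at h1
  have h2 := real_inner_le_norm v (act A⁻¹ v)
  rw [← div_eq_inv_mul, le_div_iff₀ hc]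
  rcases (norm_nonneg (act A⁻¹ v)).eq_or_lt with h0 | h0
  · rw [← h0]
    simp
  · nlinarith

/-! ### Spiked covariance matrices and eigenvalue thresholding -/

lemma isHermitian_smul_outer (c : ℝ) (u : Vec p) : (c • outer u).IsHermitian := by
  unfold Matrix.IsHermitian
  rw [Matrix.conjTranspose_smul, (outer_isHermitian u).eq, star_trivial]

lemma isHermitian_sum_smul_outer {ι : Type*} (s : Finset ι) (c : ι → ℝ) (u : ι → Vec p) :
    (∑ i ∈ s, c i • outer (u i)).IsHermitian := by
  unfold Matrix.IsHermitian
  rw [Matrix.conjTranspose_sum]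
  exact Finset.sum_congr rfl fun i _ => isHermitian_smul_outer _ _

lemma act_sum_smul_outer {ι : Type*} (s : Finset ι) (c : ι → ℝ) (u : ι → Vec p) (v : Vec p) :
    act (∑ i ∈ s, c i • outer (u i)) v = ∑ i ∈ s, (c i * ⟪u i, v⟫) • u i := by
  simp only [act_sum_left, act_smul_left, act_outer, smul_smul]

lemma inner_act_sum_smul_outer {ι : Type*} (s : Finset ι) (c : ι → ℝ) (u : ι → Vec p)
    (v : Vec p) :
    ⟪act (∑ i ∈ s, c i • outer (u i)) v, v⟫ = ∑ i ∈ s, c i * ⟪u i, v⟫ ^ 2 := by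
  simp only [act_sum_smul_outer, sum_inner, real_inner_smul_left]
  exact Finset.sum_congr rfl fun i _ => by ring

section Spiked

variable {r : ℕ} {σ : ℝ} {Sig : Matrix (Fin p) (Fin p) ℝ}

lemma IsSpiked.isHermitian (h : IsSpiked r σ Sig) : Sig.IsHermitian := by
  obtain ⟨θ, u, -, -, rfl⟩ := h
  refine Matrix.IsHermitian.add ?_ (isHermitian_sum_smul_outer _ _ _)
  simp [Matrix.IsHermitian]

lemma IsSpiked.le_inner (h : IsSpiked r σ Sig) (w : Vec p) :
    σ ^ 2 * ‖w‖ ^ 2 ≤ ⟪act Sig w, w⟫ := by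
  obtain ⟨θ, u, hθ, -, rfl⟩ := h
  rw [act_add_left, inner_add_left, inner_act_sum_smul_outer, act_smul_left, act_one,
    real_inner_smul_left, real_inner_self_eq_norm_sq]
  have : 0 ≤ ∑ i, θ i * ⟪u i, w⟫ ^ 2 :=
    Finset.sum_nonneg fun i _ => mul_nonneg (hθ i) (sq_nonneg _)
  linarith

lemma IsSpiked.posSemidef (h : IsSpiked r σ Sig) : Sig.PosSemidef := by
  refine Matrix.PosSemidef.of_dotProduct_mulVec_nonneg h.isHermitian fun v => ?_
  have h1 := h.le_inner (WithLp.toLp 2 v)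
  rw [act, real_inner_comm, inner_toEuclideanCLM] at h1
  have : 0 ≤ σ ^ 2 * ‖WithLp.toLp 2 v‖ ^ 2 := by positivity
  simpa using this.trans h1

lemma act_eigenvectorBasis (hA : A.IsHermitian) (j : Fin p) :
    act A (hA.eigenvectorBasis j) = hA.eigenvalues j • hA.eigenvectorBasis j := by
  ext l
  simp only [act, ofLp_toEuclideanCLM]
  rw [hA.mulVec_eigenvectorBasis]
  simp

/-- The `(r+1)`-st largest eigenvalue is at most `σ²` up to the distance from the spiked matrix. -/
lemma IsSpiked.eigNext_le {r : Fin p} (h : IsSpiked r σ Sig) (hA : A.IsHermitian) {δ : ℝ}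
    (hδ : ∀ w, |⟪act A w, w⟫ - ⟪act Sig w, w⟫| ≤ δ * ‖w‖ ^ 2) : eigNext hA r ≤ σ ^ 2 + δ := by
  classical
  obtain ⟨θ, u, hθ, hu, rfl⟩ := h
  have hcard : (r : ℕ) + 1 ≤ Fintype.card (Fin p) := by
    rw [Fintype.card_fin]
    omega
  -- `eigenvalues` is the decreasing list `eigenvalues₀` read through this equivalence, so `k`
  -- enumerates the `r + 1` top indices.
  set e := Fintype.equivOfCardEq (Fintype.card_fin (Fintype.card (Fin p))) with he
  set k : Fin ((r : ℕ) + 1) → Fin p := fun i => e (Fin.castLE hcard i) with hk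
  have hkinj : Function.Injective k := e.injective.comp (Fin.castLE_injective hcard)
  have hkge : ∀ i, eigNext hA r ≤ hA.eigenvalues (k i) := fun i => by
    have : hA.eigenvalues (k i) = hA.eigenvalues₀ (Fin.castLE hcard i) := by
      simp only [Matrix.IsHermitian.eigenvalues, hk, he, Equiv.symm_apply_apply]
    rw [this, eigNext]
    refine hA.eigenvalues₀_antitone ?_
    rw [Fin.le_def]
    simp
    omega
  -- Sends coefficients on the top `r + 1` eigenvectors to the inner products with the `r` spikes.
  -- By dimension its kernel is nonzero, which gives a vector orthogonal to every spike, where the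
  -- form of `Σ` is exactly `σ² ‖v‖²`.
  set f : (Fin ((r : ℕ) + 1) → ℝ) →ₗ[ℝ] (Fin (r : ℕ) → ℝ) :=
    LinearMap.pi fun j => ∑ i, (⟪u j, hA.eigenvectorBasis (k i)⟫ : ℝ) • LinearMap.proj i with hf
  obtain ⟨c, hc, hc0⟩ := (Submodule.ne_bot_iff _).1
    (LinearMap.ker_ne_bot_of_finrank_lt (f := f) (by simp))
  set v : Vec p := ∑ i, c i • hA.eigenvectorBasis (k i) with hv
  have hon : Orthonormal ℝ fun i => hA.eigenvectorBasis (k i) :=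
    hA.eigenvectorBasis.orthonormal.comp k hkinj
  have huv : ∀ j, ⟪u j, v⟫ = 0 := fun j => by
    have := congrFun (LinearMap.mem_ker.1 hc) j
    simp only [hf, LinearMap.pi_apply, LinearMap.sum_apply, LinearMap.smul_apply,
      LinearMap.proj_apply, smul_eq_mul, Pi.zero_apply] at this
    rw [hv, inner_sum, ← this]
    exact Finset.sum_congr rfl fun i _ => by rw [inner_smul_right, mul_comm]
  have hvn : ‖v‖ ^ 2 = ∑ i, c i ^ 2 := by
    rw [← real_inner_self_eq_norm_sq, hv, hon.inner_sum]
    simp [sq]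
  have hv0 : 0 < ‖v‖ ^ 2 := by
    rw [hvn]
    obtain ⟨i, hi⟩ := Function.ne_iff.1 hc0
    have hi' : 0 < c i ^ 2 := by
      have : c i ≠ 0 := hi
      positivity
    exact hi'.trans_le (Finset.single_le_sum (f := fun i => c i ^ 2)
      (fun i _ => sq_nonneg (c i)) (Finset.mem_univ i))
  have hAv : ⟪act A v, v⟫ = ∑ i, hA.eigenvalues (k i) * c i ^ 2 := by
    have : act A v = ∑ i, (hA.eigenvalues (k i) * c i) • hA.eigenvectorBasis (k i) := by
      rw [hv, act, map_sum]
      refine Finset.sum_congr rfl fun i _ => ?_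
      have := act_eigenvectorBasis hA (k i)
      rw [act] at this
      rw [map_smul, this, smul_smul, mul_comm]
    rw [this, hv, hon.inner_sum]
    refine Finset.sum_congr rfl fun i _ => ?_
    simp
    ring
  have hAge : eigNext hA r * ‖v‖ ^ 2 ≤ ⟪act A v, v⟫ := by
    rw [hAv, hvn, Finset.mul_sum]
    exact Finset.sum_le_sum fun i _ => mul_le_mul_of_nonneg_right (hkge i) (sq_nonneg _)
  have hSv : ⟪act (σ ^ 2 • (1 : Matrix (Fin p) (Fin p) ℝ) + ∑ i, θ i • outer (u i)) v, v⟫ =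
      σ ^ 2 * ‖v‖ ^ 2 := by
    rw [act_add_left, inner_add_left, inner_act_sum_smul_outer, act_smul_left, act_one,
      real_inner_smul_left, real_inner_self_eq_norm_sq]
    simp [huv]
  have h1 := (abs_le.1 (hδ v)).2
  rw [hSv] at h1
  have : eigNext hA r * ‖v‖ ^ 2 ≤ (σ ^ 2 + δ) * ‖v‖ ^ 2 := by linarith
  exact le_of_mul_le_mul_right this hv0

lemma eigThreshold_isHermitian (hA : A.IsHermitian) (r : Fin p) :
    (eigThreshold hA r).IsHermitian := isHermitian_sum_smul_outer _ _ _

lemma inner_act_eq_sum_eigenvalues (hA : A.IsHermitian) (w : Vec p) :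
    ⟪act A w, w⟫ = ∑ j, hA.eigenvalues j * ⟪hA.eigenvectorBasis j, w⟫ ^ 2 := by
  rw [← (hA.eigenvectorBasis).sum_inner_mul_inner]
  refine Finset.sum_congr rfl fun j _ => ?_
  rw [inner_act_comm hA, act_eigenvectorBasis, inner_smul_right, real_inner_comm w]
  ring

lemma IsSpiked.le_eigenvalues (h : IsSpiked r σ Sig) (hA : A.IsHermitian) {δ : ℝ}
    (hδ : ∀ w, |⟪act A w, w⟫ - ⟪act Sig w, w⟫| ≤ δ * ‖w‖ ^ 2) (j : Fin p) :
    σ ^ 2 - δ ≤ hA.eigenvalues j := by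
  have h1 := h.le_inner (hA.eigenvectorBasis j)
  have h2 := (abs_le.1 (hδ (hA.eigenvectorBasis j))).1
  have h3 : ‖hA.eigenvectorBasis j‖ = 1 := hA.eigenvectorBasis.orthonormal.1 j
  rw [act_eigenvectorBasis, real_inner_smul_left, real_inner_self_eq_norm_sq, h3] at h2
  rw [h3] at h1
  linarith

lemma IsSpiked.le_inner_eigThreshold (h : IsSpiked r σ Sig) (hA : A.IsHermitian) {δ : ℝ}
    (hδ : ∀ w, |⟪act A w, w⟫ - ⟪act Sig w, w⟫| ≤ δ * ‖w‖ ^ 2) (q : Fin p) (w : Vec p) :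
    (σ ^ 2 - δ) * ‖w‖ ^ 2 ≤ ⟪act (eigThreshold hA q) w, w⟫ := by
  rw [eigThreshold, inner_act_sum_smul_outer, ← hA.eigenvectorBasis.sum_sq_inner_right,
    Finset.mul_sum]
  exact Finset.sum_le_sum fun j _ => mul_le_mul_of_nonneg_right
    ((h.le_eigenvalues hA hδ j).trans (le_max_left _ _)) (sq_nonneg _)

/-- Thresholding moves a perturbation of a spiked matrix by at most twice the perturbation. -/
lemma IsSpiked.abs_inner_eigThreshold_sub_le {r : Fin p} (h : IsSpiked r σ Sig)
    (hA : A.IsHermitian) {δ : ℝ} (hδ0 : 0 ≤ δ)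
    (hδ : ∀ w, |⟪act A w, w⟫ - ⟪act Sig w, w⟫| ≤ δ * ‖w‖ ^ 2) (w : Vec p) :
    |⟪act (eigThreshold hA r) w, w⟫ - ⟪act Sig w, w⟫| ≤ 3 * δ * ‖w‖ ^ 2 := by
  have h1 : |⟪act (eigThreshold hA r) w, w⟫ - ⟪act A w, w⟫| ≤ 2 * δ * ‖w‖ ^ 2 := by
    rw [eigThreshold, inner_act_sum_smul_outer, inner_act_eq_sum_eigenvalues hA,
      ← Finset.sum_sub_distrib, ← hA.eigenvectorBasis.sum_sq_inner_right, Finset.mul_sum]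
    refine (Finset.abs_sum_le_sum_abs _ _).trans (Finset.sum_le_sum fun j _ => ?_)
    rw [← sub_mul, abs_mul, abs_of_nonneg (sq_nonneg ⟪_, _⟫)]
    refine mul_le_mul_of_nonneg_right ?_ (sq_nonneg _)
    -- Every eigenvalue is at least `σ² - δ` and the threshold is at most `σ² + δ`, so no eigenvalue
    -- is raised by more than `2δ`. Comparing `A` with `Σ` costs the third `δ`.
    have h2 := h.le_eigenvalues hA hδ j
    have h3 := h.eigNext_le hA hδ
    rw [abs_of_nonneg (sub_nonneg.2 (le_max_left _ _)), sub_le_iff_le_add]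
    exact max_le (by linarith) (by linarith)
  have h2 := hδ w
  have : ⟪act (eigThreshold hA r) w, w⟫ - ⟪act Sig w, w⟫ =
      (⟪act (eigThreshold hA r) w, w⟫ - ⟪act A w, w⟫) + (⟪act A w, w⟫ - ⟪act Sig w, w⟫) := by ring
  rw [this]
  refine (abs_add_le _ _).trans ?_
  linarith

end Spiked

end LinearAlgebra

/-! ### Taylor estimates on the line -/

section Taylor

lemma abs_sub_le_of_abs_deriv_le {g g₁ : ℝ → ℝ} {L : ℝ} (hg : ∀ u, HasDerivAt g (g₁ u) u)
    (hL : ∀ u, |g₁ u| ≤ L) (a b : ℝ) : |g b - g a| ≤ L * |b - a| :=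
  Convex.norm_image_sub_le_of_norm_hasDerivWithin_le (s := Set.univ)
    (fun u _ => (hg u).hasDerivWithinAt) (fun u _ => hL u) convex_univ (Set.mem_univ _)
    (Set.mem_univ _)

/-- The mean value inequality for `g u - g₁ a * u` on the segment; it yields `L` in place of the
sharp `L / 2`. -/
lemma abs_taylor_one_le {g g₁ g₂ : ℝ → ℝ} {L : ℝ} (hg : ∀ u, HasDerivAt g (g₁ u) u)
    (hg₁ : ∀ u, HasDerivAt g₁ (g₂ u) u) (hL : ∀ u, |g₂ u| ≤ L) (a b : ℝ) :
    |g b - g a - g₁ a * (b - a)| ≤ L * (b - a) ^ 2 := by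
  have hL0 : 0 ≤ L := (abs_nonneg _).trans (hL 0)
  have key := Convex.norm_image_sub_le_of_norm_hasDerivWithin_le
    (f := fun u => g u - g₁ a * u) (f' := fun u => g₁ u - g₁ a) (s := Set.uIcc a b)
    (C := L * |b - a|) (x := a) (y := b)
    (fun u _ => ((hg u).sub (by simpa using (hasDerivAt_id' u).const_mul (g₁ a))).hasDerivWithinAt)
    (fun u hu => (abs_sub_le_of_abs_deriv_le hg₁ hL a u).trans
      (mul_le_mul_of_nonneg_left (Set.abs_sub_left_of_mem_uIcc hu) hL0))
    (convex_uIcc a b) Set.left_mem_uIcc Set.right_mem_uIcc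
  rw [Real.norm_eq_abs, Real.norm_eq_abs, mul_assoc, abs_mul_abs_self] at key
  calc _ = |g b - g₁ a * b - (g a - g₁ a * a)| := by congr 1; ring
    _ ≤ _ := key
    _ = _ := by ring

/-- Landau's inequality: the first derivative is controlled by the function and its second
derivative. -/
lemma abs_deriv_le_of_abs_le {g g₁ g₂ : ℝ → ℝ} {b₀ b₂ : ℝ} (hg : ∀ u, HasDerivAt g (g₁ u) u)
    (hg₁ : ∀ u, HasDerivAt g₁ (g₂ u) u) (h₀ : ∀ u, |g u| ≤ b₀) (h₂ : ∀ u, |g₂ u| ≤ b₂) (a : ℝ) :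
    |g₁ a| ≤ 2 * b₀ + b₂ := by
  have h := abs_le.1 (abs_taylor_one_le hg hg₁ h₂ a (a + 1))
  have h1 := abs_le.1 (h₀ a)
  have h2 := abs_le.1 (h₀ (a + 1))
  simp only [add_sub_cancel_left, mul_one, one_pow] at h
  rw [abs_le]
  constructor <;> linarith [h.1, h.2, h1.1, h1.2, h2.1, h2.2]

lemma hasDerivAt_iteratedDeriv {φ : ℝ → ℝ} {N k : ℕ} (hφ : ContDiff ℝ N φ) (hk : k < N) (u : ℝ) :
    HasDerivAt (iteratedDeriv k φ) (iteratedDeriv (k + 1) φ u) u := by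
  rw [iteratedDeriv_succ]
  exact ((hφ.differentiable_iteratedDeriv k (by exact_mod_cast hk)) u).hasDerivAt

end Taylor

/-! ### The rank-one tensors `v ⊗ v` -/

section Tensor

variable {p : ℕ}

/-- The tensor `v ⊗ v`, with the Frobenius norm. -/
def tens (v : Vec p) : EuclideanSpace ℝ (Fin p × Fin p) :=
  WithLp.toLp 2 fun q => v q.1 * v q.2

/-- Quadratic forms of combinations of `v vᵀ` become inner products with `tens w`. Concentration of
vectors in the Frobenius norm therefore controls the spectral norm, with no factor depending on the
dimension. -/
lemma inner_tens (v w : Vec p) : ⟪tens v, tens w⟫ = ⟪v, w⟫ ^ 2 := by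
  simp only [tens, PiLp.inner_apply, RCLike.inner_apply, conj_trivial, Fintype.sum_prod_type, sq,
    Finset.sum_mul_sum]
  exact Finset.sum_congr rfl fun i _ => Finset.sum_congr rfl fun j _ => by ring

lemma norm_tens (v : Vec p) : ‖tens v‖ = ‖v‖ ^ 2 := by
  have h : ‖tens v‖ ^ 2 = (‖v‖ ^ 2) ^ 2 := by
    rw [← real_inner_self_eq_norm_sq, inner_tens, real_inner_self_eq_norm_sq]
  exact (pow_left_inj₀ (norm_nonneg _) (by positivity) two_ne_zero).1 h

lemma continuous_tens : Continuous (tens : Vec p → _) := by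
  unfold tens
  fun_prop

end Tensor

/-! ### The empirical Hessian and the gradient -/

section Deterministic

variable {n p : ℕ} {φ : ℝ → ℝ}

/-- The Hessian `(1/n) ∑ φ''(⟨xᵢ, β⟩) xᵢ xᵢᵀ` of the negative log-likelihood. -/
def empHess (φ : ℝ → ℝ) (x : Fin n → Vec p) (β : Vec p) : Matrix (Fin p) (Fin p) ℝ :=
  ∑ i, ((n : ℝ)⁻¹ * iteratedDeriv 2 φ ⟪x i, β⟫) • outer (x i)

lemma inner_act_empHess (x : Fin n → Vec p) (β w : Vec p) :
    ⟪act (empHess φ x β) w, w⟫ =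
      ⟪smean x Finset.univ fun v => iteratedDeriv 2 φ ⟪v, β⟫ • tens v, tens w⟫ := by
  rw [empHess, inner_act_sum_smul_outer, smean, real_inner_smul_left, sum_inner, Finset.mul_sum,
    Finset.card_univ, Fintype.card_fin]
  refine Finset.sum_congr rfl fun i _ => ?_
  rw [real_inner_smul_left, inner_tens]
  ring

lemma inner_act_subCov (x : Fin n → Vec p) (S : Finset (Fin n)) (w : Vec p) :
    ⟪act (subCov x S) w, w⟫ = ⟪smean x S tens, tens w⟫ := by
  rw [subCov, act_smul_left, act_sum_left, smean, real_inner_smul_left, real_inner_smul_left,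
    sum_inner, sum_inner]
  congr 1
  refine Finset.sum_congr rfl fun i _ => ?_
  rw [act_outer, real_inner_smul_left, inner_tens]
  ring

lemma empMu_eq_smean (k : ℕ) (x : Fin n → Vec p) (β : Vec p) :
    empMu k φ x β = smean x Finset.univ fun v => iteratedDeriv k φ ⟪v, β⟫ := by
  simp [empMu, smean]

lemma abs_empMu_le {k : ℕ} {B : ℝ} (hn : 0 < n) (hB : ∀ a, |iteratedDeriv k φ a| ≤ B)
    (x : Fin n → Vec p) (β : Vec p) : |empMu k φ x β| ≤ B := by
  have hn' : (0 : ℝ) < n := by exact_mod_cast hn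
  rw [empMu, abs_mul, abs_of_nonneg (by positivity), inv_mul_le_iff₀ hn']
  refine (Finset.abs_sum_le_sum_abs _ _).trans ((Finset.sum_le_sum fun i _ => hB _).trans ?_)
  simp

lemma hasGradientAt_negLogLik (hφ : Differentiable ℝ φ) (x : Fin n → Vec p) (y : Fin n → ℝ)
    (β : Vec p) :
    HasGradientAt (negLogLik φ x y)
      ((n : ℝ)⁻¹ • ∑ i, (iteratedDeriv 1 φ ⟪x i, β⟫ - y i) • x i) β := by
  rw [hasGradientAt_iff_hasFDerivAt]
  have h1 : ∀ i, HasFDerivAt (fun b : Vec p => ⟪x i, b⟫) (innerSL ℝ (x i)) β := fun i =>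
    (innerSL ℝ (x i)).hasFDerivAt
  have h2 : ∀ i, HasFDerivAt (fun b : Vec p => φ ⟪x i, b⟫ - y i * ⟪x i, b⟫)
      (iteratedDeriv 1 φ ⟪x i, β⟫ • innerSL ℝ (x i) - y i • innerSL ℝ (x i)) β := fun i => by
    rw [iteratedDeriv_one]
    exact ((hφ ⟪x i, β⟫).hasDerivAt.comp_hasFDerivAt β (h1 i)).sub ((h1 i).const_mul (y i))
  refine ((HasFDerivAt.fun_sum fun i (_ : i ∈ Finset.univ) => h2 i).const_mul
    (n : ℝ)⁻¹).congr_fderiv ?_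
  ext v
  simp [sub_mul]

lemma gradient_negLogLik_eq_zero_of_isMinOn {x : Fin n → Vec p} {y : Fin n → ℝ} {b : Vec p}
    (hb : IsMinOn (negLogLik φ x y) Set.univ b) : gradient (negLogLik φ x y) b = 0 := by
  have : fderiv ℝ (negLogLik φ x y) b = 0 :=
    (hb.isLocalMin Filter.univ_mem).fderiv_eq_zero
  rw [gradient, this, map_zero]

/-- The responses cancel in the difference of gradients, so they need no bound. What is left is the
Taylor remainder of `φ'` at each `⟪x i, β⟫`: the squared increment gives `K`, the vector `x i` gives
`√K`. -/
lemma norm_gradient_sub_empHess_le (hφ : ContDiff ℝ 3 φ) {L K : ℝ} (hK : 0 ≤ K) (hn : 0 < n)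
    (hL : ∀ u, |iteratedDeriv 3 φ u| ≤ L) {x : Fin n → Vec p} (hx : ∀ i, ‖x i‖ ≤ √K)
    (y : Fin n → ℝ) (β b : Vec p) :
    ‖gradient (negLogLik φ x y) β - gradient (negLogLik φ x y) b - act (empHess φ x β) (β - b)‖ ≤
      L * (√K * K) * ‖β - b‖ ^ 2 := by
  have hL0 : 0 ≤ L := (abs_nonneg _).trans (hL 0)
  have hn' : (0 : ℝ) < n := by exact_mod_cast hn
  have hφ1 : Differentiable ℝ φ := hφ.differentiable (by norm_num)
  rw [(hasGradientAt_negLogLik hφ1 x y β).gradient, (hasGradientAt_negLogLik hφ1 x y b).gradient,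
    empHess, act_sum_smul_outer, ← smul_sub, ← Finset.sum_sub_distrib]
  have e : ∑ i, ((n : ℝ)⁻¹ * iteratedDeriv 2 φ ⟪x i, β⟫ * ⟪x i, β - b⟫) • x i =
      (n : ℝ)⁻¹ • ∑ i, (iteratedDeriv 2 φ ⟪x i, β⟫ * ⟪x i, β - b⟫) • x i := by
    simp only [Finset.smul_sum, smul_smul, mul_assoc]
  rw [e, ← smul_sub, ← Finset.sum_sub_distrib, norm_smul, Real.norm_of_nonneg (by positivity),
    inv_mul_le_iff₀ hn']
  refine (norm_sum_le _ _).trans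
    ((Finset.sum_le_sum (g := fun _ => L * (√K * K) * ‖β - b‖ ^ 2) fun i _ => ?_).trans (by simp))
  rw [← sub_smul, ← sub_smul, norm_smul]
  have h1 := abs_taylor_one_le (g := iteratedDeriv 1 φ) (g₁ := iteratedDeriv 2 φ)
    (g₂ := iteratedDeriv 3 φ) (hasDerivAt_iteratedDeriv (N := 3) hφ (by norm_num))
    (hasDerivAt_iteratedDeriv (N := 3) hφ (by norm_num)) hL ⟪x i, β⟫ ⟪x i, b⟫
  have h2 : ‖iteratedDeriv 1 φ ⟪x i, β⟫ - y i - (iteratedDeriv 1 φ ⟪x i, b⟫ - y i) -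
      iteratedDeriv 2 φ ⟪x i, β⟫ * ⟪x i, β - b⟫‖ ≤ L * ⟪x i, β - b⟫ ^ 2 := by
    rw [Real.norm_eq_abs, ← abs_neg, inner_sub_right]
    calc _ = _ := by congr 1; ring
      _ ≤ _ := h1
      _ = _ := by ring
  have h3 : ⟪x i, β - b⟫ ^ 2 ≤ K * ‖β - b‖ ^ 2 := by
    rw [← sq_abs]
    calc |⟪x i, β - b⟫| ^ 2 ≤ (√K * ‖β - b‖) ^ 2 := by
          have := (abs_real_inner_le_norm (x i) (β - b)).trans
            (mul_le_mul_of_nonneg_right (hx i) (norm_nonneg _))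
          gcongr
      _ = _ := by rw [mul_pow, Real.sq_sqrt hK]
  calc _ ≤ (L * (K * ‖β - b‖ ^ 2)) * √K := by
        refine mul_le_mul (h2.trans ?_) (hx i) (norm_nonneg _) (by positivity)
        gcongr
    _ = _ := by ring

lemma norm_projBall_sub_le {R : ℝ} (hR : 0 < R) {b : Vec p} (hb : ‖b‖ ≤ R) (v : Vec p) :
    ‖projBall R v - b‖ ≤ ‖v - b‖ := by
  rw [projBall]
  split_ifs with h
  · exact le_rfl
  push Not at h
  have hv : 0 < ‖v‖ := hR.trans h
  set c := R / ‖v‖ with hc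
  have hc1 : c ≤ 1 := (div_le_one hv).2 h.le
  have hc0 : 0 < c := by positivity
  have hcv : c * ‖v‖ = R := by rw [hc]; field_simp
  have hin : ⟪v, b⟫ ≤ ‖v‖ * R :=
    (real_inner_le_norm v b).trans (mul_le_mul_of_nonneg_left hb hv.le)
  refine (sq_le_sq₀ (norm_nonneg _) (norm_nonneg _)).1 ?_
  rw [norm_sub_sq_real, norm_sub_sq_real, norm_smul, real_inner_smul_left,
    Real.norm_of_nonneg hc0.le, hcv]
  nlinarith [mul_nonneg (sub_nonneg.2 hc1) (sub_nonneg.2 hin), sq_nonneg (‖v‖ - R)]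

lemma norm_projBall_le {R : ℝ} (hR : 0 < R) (v : Vec p) : ‖projBall R v‖ ≤ R := by
  rw [projBall]
  split_ifs with h
  · exact h
  push Not at h
  have hv : 0 < ‖v‖ := hR.trans h
  rw [norm_smul, Real.norm_of_nonneg (by positivity)]
  exact (div_mul_cancel₀ R hv.ne').le

lemma act_scaling (x : Fin n → Vec p) (ζ : Matrix (Fin p) (Fin p) ℝ) (β v : Vec p) :
    act (scaling φ x ζ β) v = (empMu 2 φ x β)⁻¹ • (act ζ⁻¹ v -
      (empMu 4 φ x β / (empMu 2 φ x β + empMu 4 φ x β * ⟪act ζ β, β⟫) * ⟪β, v⟫) • β) := by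
  rw [scaling, act_smul_left, act_sub_left, act_smul_left, act_outer, smul_smul]

/-- The Sherman-Morrison formula. -/
lemma act_scaling_inverse {x : Fin n → Vec p} {ζ : Matrix (Fin p) (Fin p) ℝ} {β : Vec p}
    (hζ : ζ.IsHermitian) (hu : IsUnit ζ.det) (h2 : empMu 2 φ x β ≠ 0)
    (hD : empMu 2 φ x β + empMu 4 φ x β * ⟪act ζ β, β⟫ ≠ 0) (v : Vec p) :
    act (scaling φ x ζ β)
      (act (empMu 2 φ x β • ζ + empMu 4 φ x β • outer (act ζ β)) v) = v := by
  rw [act_add_left, act_smul_left, act_smul_left, act_outer, smul_smul, act_scaling,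
    act_add_right, act_smul_right, act_smul_right, act_inv_act hu, act_inv_act hu,
    inner_add_right, inner_smul_right, inner_smul_right, ← inner_act_comm hζ β v,
    real_inner_comm (act ζ β) β]
  set a := empMu 2 φ x β
  set b := empMu 4 φ x β
  set q := ⟪act ζ β, β⟫
  set t := ⟪act ζ β, v⟫
  -- The denominator of the correction is chosen so that the coefficients of `β` cancel.
  have : a • v + (b * t) • β - (b / (a + b * q) * (a * t + b * t * q)) • β = a • v := by
    rw [add_sub_assoc, ← sub_smul]
    have : b * t - b / (a + b * q) * (a * t + b * t * q) = 0 := by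
      field_simp
      ring
    rw [this, zero_smul, add_zero]
  rw [this, smul_smul, inv_mul_cancel₀ h2, one_smul]

/-- `c⁻¹` bounds `ζ⁻¹` and `B R² / ξ` bounds the rank-one correction. At `m/2`, `σ²/2` and `ξ/2`
this is the constant `κ`. -/
lemma norm_act_scaling_le {x : Fin n → Vec p} {ζ : Matrix (Fin p) (Fin p) ℝ} {β : Vec p}
    {m c ξ B R : ℝ} (hm : 0 < m) (hc : 0 < c) (hξ : 0 < ξ)
    (hζ : ∀ w, c * ‖w‖ ^ 2 ≤ ⟪act ζ w, w⟫) (h2 : m ≤ empMu 2 φ x β)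
    (h4 : |empMu 4 φ x β| ≤ B) (hβ : ‖β‖ ≤ R)
    (hD : ξ ≤ |empMu 2 φ x β + empMu 4 φ x β * ⟪act ζ β, β⟫|) (v : Vec p) :
    ‖act (scaling φ x ζ β) v‖ ≤ m⁻¹ * (c⁻¹ + B / ξ * R ^ 2) * ‖v‖ := by
  have hB : 0 ≤ B := (abs_nonneg _).trans h4
  have hR : 0 ≤ R := (norm_nonneg _).trans hβ
  rw [act_scaling, norm_smul, norm_inv, Real.norm_of_nonneg (hm.le.trans h2), mul_assoc]
  gcongr
  refine (norm_sub_le _ _).trans ?_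
  rw [add_mul]
  refine add_le_add (norm_act_inv_le hc hζ v) ?_
  rw [norm_smul, norm_mul, norm_div, Real.norm_eq_abs, Real.norm_eq_abs, Real.norm_eq_abs]
  calc _ ≤ B / ξ * (R * ‖v‖) * R := by
        gcongr
        exact (abs_real_inner_le_norm β v).trans (by gcongr)
    _ = _ := by ring

/-- One step of the method, given bounds on the scaling matrix and on its quality as an
approximation of the inverse Hessian. -/
lemma norm_step_le (hφ : ContDiff ℝ 3 φ) {L K R κ Δ : ℝ} (hK : 0 ≤ K) (hR : 0 < R) (hn : 0 < n)
    (hL : ∀ u, |iteratedDeriv 3 φ u| ≤ L) {x : Fin n → Vec p} (hx : ∀ i, ‖x i‖ ≤ √K)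
    {y : Fin n → ℝ} {β b : Vec p} (hb : ‖b‖ ≤ R) (hmin : IsMinOn (negLogLik φ x y) Set.univ b)
    {ζ : Matrix (Fin p) (Fin p) ℝ} (hζ : ζ.IsHermitian) (hu : IsUnit ζ.det)
    (h2 : empMu 2 φ x β ≠ 0) (hD : empMu 2 φ x β + empMu 4 φ x β * ⟪act ζ β, β⟫ ≠ 0)
    (hκ0 : 0 ≤ κ) (hκ : ∀ v, ‖act (scaling φ x ζ β) v‖ ≤ κ * ‖v‖)
    (hΔ : ∀ w : Vec p, ‖w‖ = 1 → |empMu 2 φ x β * ⟪act ζ w, w⟫ +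
      empMu 4 φ x β * ⟪act ζ β, w⟫ ^ 2 - ⟪act (empHess φ x β) w, w⟫| ≤ Δ) :
    ‖projBall R (β - (1 : ℝ) • act (scaling φ x ζ β) (gradient (negLogLik φ x y) β)) - b‖ ≤
      κ * Δ * ‖β - b‖ + κ * (L * (√K * K)) * ‖β - b‖ ^ 2 := by
  refine (norm_projBall_sub_le hR hb _).trans ?_
  set A := empMu 2 φ x β • ζ + empMu 4 φ x β • outer (act ζ β) - empHess φ x β with hA
  have hAh : A.IsHermitian := by
    refine ((Matrix.IsHermitian.add ?_ (isHermitian_smul_outer _ _)).sub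
      (isHermitian_sum_smul_outer _ _ _))
    unfold Matrix.IsHermitian
    rw [Matrix.conjTranspose_smul, hζ.eq, star_trivial]
  have hAq : ∀ w, ⟪act A w, w⟫ = empMu 2 φ x β * ⟪act ζ w, w⟫ +
      empMu 4 φ x β * ⟪act ζ β, w⟫ ^ 2 - ⟪act (empHess φ x β) w, w⟫ := fun w => by
    rw [hA, act_sub_left, act_add_left, act_smul_left, act_smul_left, act_outer, inner_sub_left,
      inner_add_left, real_inner_smul_left, real_inner_smul_left, real_inner_smul_left]
    ring
  have hAΔ : ∀ w, |⟪act A w, w⟫| ≤ Δ * ‖w‖ ^ 2 := fun w => by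
    rcases eq_or_ne w 0 with rfl | hw
    · simp [act]
    have hw' : 0 < ‖w‖ := norm_pos_iff.2 hw
    have h1 : ‖‖w‖⁻¹ • w‖ = 1 := by
      rw [norm_smul, norm_inv, norm_norm, inv_mul_cancel₀ hw'.ne']
    have h2 := hΔ _ h1
    rw [← hAq, act_smul_right, real_inner_smul_left, inner_smul_right, abs_mul, abs_mul,
      abs_of_pos (inv_pos.2 hw')] at h2
    calc |⟪act A w, w⟫| = (‖w‖⁻¹ * (‖w‖⁻¹ * |⟪act A w, w⟫|)) * ‖w‖ ^ 2 := by field_simp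
      _ ≤ _ := by gcongr
  have hg := norm_gradient_sub_empHess_le hφ hK hn hL hx y β b
  rw [gradient_negLogLik_eq_zero_of_isMinOn hmin, sub_zero] at hg
  set g := gradient (negLogLik φ x y) β
  -- By Sherman-Morrison `β - b` is itself in the form `Q` applied to a vector, so the whole error
  -- factors through `Q`.
  have e : β - (1 : ℝ) • act (scaling φ x ζ β) g - b =
      act (scaling φ x ζ β) (act A (β - b) - (g - act (empHess φ x β) (β - b))) := by
    have h1 := act_scaling_inverse hζ hu h2 hD (β - b)
    have h3 : act A (β - b) - (g - act (empHess φ x β) (β - b)) =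
        act (empMu 2 φ x β • ζ + empMu 4 φ x β • outer (act ζ β)) (β - b) - g := by
      rw [hA, act_sub_left]
      abel
    rw [h3, act_sub_right, h1, one_smul]
    abel
  rw [e]
  calc _ ≤ κ * (‖act A (β - b)‖ + ‖g - act (empHess φ x β) (β - b)‖) :=
        (hκ _).trans (mul_le_mul_of_nonneg_left (norm_sub_le _ _) hκ0)
    _ ≤ κ * (Δ * ‖β - b‖ + L * (√K * K) * ‖β - b‖ ^ 2) := by
        gcongr
        exact norm_act_le_of_abs_inner_le hAh hAΔ _
    _ = _ := by ring

end Deterministic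

/-! ### Population quantities -/

section Population

variable {p : ℕ} {φ : ℝ → ℝ} {K R : ℝ} {Sig : Matrix (Fin p) (Fin p) ℝ} {ρ : Measure (Vec p)}
  [IsProbabilityMeasure ρ]

lemma integrable_tens (hK0 : 0 ≤ K) (hK : ∀ᵐ v ∂ρ, ‖v‖ ≤ √K) : Integrable tens ρ :=
  Integrable.of_bound continuous_tens.aestronglyMeasurable K (by
    filter_upwards [hK] with v hv
    rw [norm_tens, ← Real.sq_sqrt hK0]
    gcongr)

lemma inner_integral_tens (hK0 : 0 ≤ K) (hK : ∀ᵐ v ∂ρ, ‖v‖ ≤ √K)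
    (hSig : ∀ j k, ∫ v, v j * v k ∂ρ = Sig j k) (w : Vec p) :
    ⟪∫ v, tens v ∂ρ, tens w⟫ = ⟪act Sig w, w⟫ := by
  have hcoord : ∀ q, (∫ v, tens v ∂ρ) q = Sig q.1 q.2 := fun q => by
    have := (EuclideanSpace.proj (𝕜 := ℝ) q).integral_comp_comm (integrable_tens hK0 hK)
    simp only [EuclideanSpace.coe_proj] at this
    rw [← this, ← hSig]
    rfl
  rw [act, real_inner_comm w (Matrix.toEuclideanCLM (𝕜 := ℝ) Sig w), inner_toEuclideanCLM]
  simp only [PiLp.inner_apply, hcoord, RCLike.inner_apply, conj_trivial, Fintype.sum_prod_type,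
    dotProduct, mulVec, Finset.mul_sum]
  refine Finset.sum_congr rfl fun i _ => Finset.sum_congr rfl fun j _ => ?_
  simp only [tens]
  ring

lemma norm_integral_tens_le (hK0 : 0 ≤ K) (hK : ∀ᵐ v ∂ρ, ‖v‖ ≤ √K) :
    ‖∫ v, tens v ∂ρ‖ ≤ K := by
  have := norm_integral_le_of_norm_le_const (μ := ρ) (f := tens) (C := K) (by
    filter_upwards [hK] with v hv
    rw [norm_tens, ← Real.sq_sqrt hK0]
    gcongr)
  simpa using this

lemma abs_inner_act_cov_le (hK0 : 0 ≤ K) (hK : ∀ᵐ v ∂ρ, ‖v‖ ≤ √K)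
    (hSig : ∀ j k, ∫ v, v j * v k ∂ρ = Sig j k) (w : Vec p) :
    |⟪act Sig w, w⟫| ≤ K * ‖w‖ ^ 2 := by
  rw [← inner_integral_tens hK0 hK hSig, ← norm_tens]
  exact (abs_real_inner_le_norm _ _).trans
    (mul_le_mul_of_nonneg_right (norm_integral_tens_le hK0 hK) (norm_nonneg _))

lemma inner_integral_smul_tens {f : ℝ → ℝ} (hf : Continuous f) {b : ℝ} (hb : ∀ u, |f u| ≤ b)
    (hK0 : 0 ≤ K) (hK : ∀ᵐ v ∂ρ, ‖v‖ ≤ √K) (β w : Vec p) :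
    ⟪∫ v, f ⟪v, β⟫ • tens v ∂ρ, tens w⟫ = ∫ v, ⟪w, v⟫ ^ 2 * f ⟪v, β⟫ ∂ρ := by
  have hm : Continuous fun v : Vec p => f ⟪v, β⟫ := by fun_prop
  have hi : Integrable (fun v : Vec p => f ⟪v, β⟫ • tens v) ρ :=
    (integrable_tens hK0 hK).bdd_smul b hm.aestronglyMeasurable
      (Filter.Eventually.of_forall fun v => hb _)
  rw [real_inner_comm, ← integral_inner hi]
  refine integral_congr_ae (Filter.Eventually.of_forall fun v => ?_)
  simp only
  rw [inner_smul_right, inner_tens]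
  ring

/-- The uniform bounds are essential: `dist` is a real `sSup`, whose value on a set unbounded above
is `0`. -/
lemma abs_integral_sub_le_dist {E : Type*} [MeasurableSpace E] {H : Set (E → ℝ)}
    {ρ ν : Measure E} {b b' : ℝ} (hρ : ∀ h ∈ H, |∫ v, h v ∂ρ| ≤ b)
    (hν : ∀ h ∈ H, |∫ v, h v ∂ν| ≤ b') {h : E → ℝ} (hh : h ∈ H) :
    |∫ v, h v ∂ρ - ∫ v, h v ∂ν| ≤ dist H ρ ν := by
  refine le_csSup ⟨b + b', ?_⟩ ⟨h, hh, rfl⟩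
  rintro _ ⟨g, hg, rfl⟩
  exact (abs_sub _ _).trans (add_le_add (hρ g hg) (hν g hg))

lemma abs_popMu_sub_le_dist {k : ℕ} {b : ℝ} (hb : ∀ u, |iteratedDeriv k φ u| ≤ b)
    (ν : Measure (Vec p)) [IsProbabilityMeasure ν] {β : Vec p} (hβ : ‖β‖ ≤ R) :
    |popMu k φ ρ β - popMu k φ ν β| ≤ dist (classDeriv p k φ R) ρ ν := by
  have key : ∀ (μ : Measure (Vec p)) [IsProbabilityMeasure μ], ∀ h ∈ classDeriv p k φ R,
      |∫ v, h v ∂μ| ≤ b := by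
    rintro μ _ _ ⟨β', -, rfl⟩
    have := norm_integral_le_of_norm_le_const (μ := μ)
      (f := fun v => iteratedDeriv k φ ⟪v, β'⟫) (C := b)
      (Filter.Eventually.of_forall fun v => hb _)
    simpa using this
  exact abs_integral_sub_le_dist (key ρ) (key ν) ⟨β, hβ, rfl⟩

lemma abs_integral_hess_sub_le_dist {b : ℝ} (hb : ∀ u, |iteratedDeriv 2 φ u| ≤ b)
    {ρ' ν : Measure (Vec p)} (hρ : Integrable (fun v => ‖v‖ ^ 2) ρ')
    (hν : Integrable (fun v => ‖v‖ ^ 2) ν) {β w : Vec p} (hβ : ‖β‖ ≤ R) (hw : ‖w‖ = 1) :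
    |∫ v, ⟪w, v⟫ ^ 2 * iteratedDeriv 2 φ ⟪v, β⟫ ∂ρ' -
      ∫ v, ⟪w, v⟫ ^ 2 * iteratedDeriv 2 φ ⟪v, β⟫ ∂ν| ≤ dist (classHess p φ R) ρ' ν := by
  have key : ∀ (μ : Measure (Vec p)), Integrable (fun v => ‖v‖ ^ 2) μ →
      ∀ h ∈ classHess p φ R, |∫ v, h v ∂μ| ≤ ∫ v, ‖v‖ ^ 2 * b ∂μ := by
    rintro μ hμ _ ⟨β', w', -, hw', rfl⟩
    rw [← Real.norm_eq_abs]
    refine norm_integral_le_of_norm_le (hμ.mul_const b) (Filter.Eventually.of_forall fun v => ?_)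
    rw [Real.norm_eq_abs, abs_mul, abs_of_nonneg (sq_nonneg _)]
    have h1 : ⟪w', v⟫ ^ 2 ≤ ‖v‖ ^ 2 := by
      rw [← sq_abs]
      have := abs_real_inner_le_norm w' v
      rw [hw', one_mul] at this
      gcongr
    exact mul_le_mul h1 (hb _) (abs_nonneg _) (sq_nonneg _)
  exact abs_integral_sub_le_dist (key ρ' hρ) (key ν hν) ⟨β, w, hβ, hw, rfl⟩

/-- The population version of the Newton-Stein approximation of the Hessian. -/
lemma abs_hess_sub_le_bigDist {r : ℕ} {σ B₂ B₃ B₄ : ℝ} (hσ : 0 < σ) (hsp : IsSpiked r σ Sig)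
    (hφ : ContDiff ℝ 5 φ) (h2 : ∀ a, |iteratedDeriv 2 φ a| ≤ B₂)
    (h3 : ∀ a, |iteratedDeriv 3 φ a| ≤ B₃) (h4 : ∀ a, |iteratedDeriv 4 φ a| ≤ B₄)
    (hK0 : 0 ≤ K) (hK : ∀ᵐ v ∂ρ, ‖v‖ ≤ √K) {β w : Vec p} (hβ : ‖β‖ ≤ R) (hw : ‖w‖ = 1) :
    |popMu 2 φ ρ β * ⟪act Sig w, w⟫ + popMu 4 φ ρ β * ⟪act Sig β, w⟫ ^ 2 -
      ∫ v, ⟪w, v⟫ ^ 2 * iteratedDeriv 2 φ ⟪v, β⟫ ∂ρ| ≤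
      bigDist φ R Sig ρ (multivariateGaussian 0 Sig) := by
  set γ := multivariateGaussian 0 Sig with hγ
  have hD : ∀ k, k < 5 → ∀ u, HasDerivAt (iteratedDeriv k φ) (iteratedDeriv (k + 1) φ u) u :=
    fun k hk => hasDerivAt_iteratedDeriv (N := 5) hφ hk
  have stein : ∫ v, ⟪w, v⟫ ^ 2 * iteratedDeriv 2 φ ⟪v, β⟫ ∂γ =
      popMu 2 φ γ β * ⟪act Sig w, w⟫ + popMu 4 φ γ β * ⟪act Sig β, w⟫ ^ 2 :=
    integral_sq_inner_mul_multivariateGaussian hsp.posSemidef (hD 2 (by norm_num))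
      (hD 3 (by norm_num))
      (continuous_iff_continuousAt.2 fun u => (hD 4 (by norm_num) u).continuousAt) h2 h3 h4 β w
      fun hβ0 => lt_of_lt_of_le (by have := norm_pos_iff.2 hβ0; positivity) (hsp.le_inner β)
  have hρ2 : Integrable (fun v : Vec p => ‖v‖ ^ 2) ρ := by
    simpa only [norm_tens] using (integrable_tens hK0 hK).norm
  have hγ2 : Integrable (fun v : Vec p => ‖v‖ ^ 2) γ :=
    (IsGaussian.memLp_two_id (μ := γ)).integrable_norm_pow (by norm_num)
  have d1 := abs_popMu_sub_le_dist (ρ := ρ) h2 γ hβ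
  have d2 := abs_popMu_sub_le_dist (ρ := ρ) h4 γ hβ
  have d3 := abs_integral_hess_sub_le_dist h2 hρ2 hγ2 hβ hw
  have hop : ∀ v : Vec p, ‖act Sig v‖ ≤ specNorm Sig * ‖v‖ := fun v =>
    (Matrix.toEuclideanCLM (𝕜 := ℝ) Sig).le_opNorm v
  have hs : |⟪act Sig w, w⟫| ≤ specNorm Sig := by
    have := (abs_real_inner_le_norm (act Sig w) w).trans
      (mul_le_mul_of_nonneg_right (hop w) (norm_nonneg w))
    simpa [hw] using this
  have hn0 : 0 ≤ specNorm Sig := norm_nonneg _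
  have hs2 : ⟪act Sig β, w⟫ ^ 2 ≤ specNorm Sig ^ 2 * R ^ 2 := by
    have h1 := (abs_real_inner_le_norm (act Sig β) w).trans
      (mul_le_mul_of_nonneg_right (hop β) (norm_nonneg w))
    rw [hw, mul_one] at h1
    rw [← sq_abs, ← mul_pow]
    have h2 : |⟪act Sig β, w⟫| ≤ specNorm Sig * R := h1.trans (by gcongr)
    gcongr
  -- The same expression for the Gaussian law is zero by Stein's identity. Subtracting it leaves one
  -- difference of expectations for each of the three classes in `bigDist`.
  have e : popMu 2 φ ρ β * ⟪act Sig w, w⟫ + popMu 4 φ ρ β * ⟪act Sig β, w⟫ ^ 2 -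
      ∫ v, ⟪w, v⟫ ^ 2 * iteratedDeriv 2 φ ⟪v, β⟫ ∂ρ =
      ⟪act Sig w, w⟫ * (popMu 2 φ ρ β - popMu 2 φ γ β) +
      ⟪act Sig β, w⟫ ^ 2 * (popMu 4 φ ρ β - popMu 4 φ γ β) +
      -(∫ v, ⟪w, v⟫ ^ 2 * iteratedDeriv 2 φ ⟪v, β⟫ ∂ρ -
        ∫ v, ⟪w, v⟫ ^ 2 * iteratedDeriv 2 φ ⟪v, β⟫ ∂γ) := by
    rw [stein]
    ring
  rw [e, bigDist]
  refine (abs_add_three _ _ _).trans (add_le_add (add_le_add ?_ ?_) ?_)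
  · rw [abs_mul]
    exact mul_le_mul hs d1 (abs_nonneg _) hn0
  · rw [abs_mul, abs_of_nonneg (sq_nonneg ⟪_, _⟫)]
    exact mul_le_mul hs2 d2 (abs_nonneg _) (by positivity)
  · rw [abs_neg]
    exact d3

/-- The contraction estimate of one Newton-Stein step on the event where the sample quantities
are close to the population quantities. -/
lemma norm_newtonStein_step_le {n : ℕ} (hn : 0 < n) {r : Fin p} {σ B₂ B₃ B₄ m ξ δ ε : ℝ}
    (hσ : 0 < σ) (hm : 0 < m) (hξ : 0 < ξ) (hR : 0 < R) (hK0 : 0 ≤ K)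
    (hsp : IsSpiked r σ Sig) (hφ : ContDiff ℝ 5 φ) (h2 : ∀ a, |iteratedDeriv 2 φ a| ≤ B₂)
    (h3 : ∀ a, |iteratedDeriv 3 φ a| ≤ B₃) (h4 : ∀ a, |iteratedDeriv 4 φ a| ≤ B₄)
    (hK : ∀ᵐ v ∂ρ, ‖v‖ ≤ √K) (hSig : ∀ j k, ∫ v, v j * v k ∂ρ = Sig j k)
    (hδ1 : δ ≤ 1) (hδσ : δ ≤ σ ^ 2 / 2) (hδξ : 3 * B₄ * δ * R ^ 2 ≤ ξ / 4)
    (hεm : ε ≤ m / 2) (hεξ : ε * (1 + K * R ^ 2) ≤ ξ / 4)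
    {x : Fin n → Vec p} (hx : ∀ i, ‖x i‖ ≤ √K) {y : Fin n → ℝ} {S : Finset (Fin n)}
    {β b : Vec p} (hβ : ‖β‖ ≤ R) (hb : ‖b‖ ≤ R) (hmβ : m ≤ popMu 2 φ ρ β)
    (hmin : IsMinOn (negLogLik φ x y) Set.univ b)
    (hξβ : ξ < |popMu 2 φ ρ β + popMu 4 φ ρ β * ⟪act Sig β, β⟫|)
    (hS : ‖smean x S tens - ∫ v, tens v ∂ρ‖ ≤ δ)
    (hμ2 : |empMu 2 φ x β - popMu 2 φ ρ β| ≤ ε) (hμ4 : |empMu 4 φ x β - popMu 4 φ ρ β| ≤ ε)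
    (hH : ‖smean x Finset.univ (fun v => iteratedDeriv 2 φ ⟪v, β⟫ • tens v) -
      ∫ v, iteratedDeriv 2 φ ⟪v, β⟫ • tens v ∂ρ‖ ≤ ε)
    {κ : ℝ} (hκ : κ = 2 / m * (2 / σ ^ 2 + 2 * B₄ * R ^ 2 / ξ)) :
    ‖projBall R (β - (1 : ℝ) • act (scaling φ x (eigThreshold (subCov_isHermitian x S) r) β)
      (gradient (negLogLik φ x y) β)) - b‖ ≤
    κ * (bigDist φ R Sig ρ (multivariateGaussian 0 Sig) +
        (3 * B₂ + 3 * B₄ * R ^ 2 * (2 * K + 3) + K + K ^ 2 * R ^ 2 + 1) * (δ + ε)) * ‖β - b‖ +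
      κ * ((2 * B₂ + B₄) * (√K * K)) * ‖β - b‖ ^ 2 := by
  have hB2 : 0 ≤ B₂ := (abs_nonneg _).trans (h2 0)
  have hB4 : 0 ≤ B₄ := (abs_nonneg _).trans (h4 0)
  have hδ0 : 0 ≤ δ := (norm_nonneg _).trans hS
  have hε0 : 0 ≤ ε := (abs_nonneg _).trans hμ2
  have hD : ∀ k, k < 5 → ∀ u, HasDerivAt (iteratedDeriv k φ) (iteratedDeriv (k + 1) φ u) u :=
    fun k hk => hasDerivAt_iteratedDeriv (N := 5) hφ hk
  -- The quadratic term involves `φ'''`, but `c₂` may depend only on `B₂` and `B₄` among the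
  -- derivative bounds; Landau's inequality replaces `B₃`.
  have hL : ∀ u, |iteratedDeriv 3 φ u| ≤ 2 * B₂ + B₄ :=
    abs_deriv_le_of_abs_le (hD 2 (by norm_num)) (hD 3 (by norm_num)) h2 h4
  have hSh := subCov_isHermitian x S
  have hδq : ∀ w : Vec p, |⟪act (subCov x S) w, w⟫ - ⟪act Sig w, w⟫| ≤ δ * ‖w‖ ^ 2 := fun w => by
    rw [inner_act_subCov, ← inner_integral_tens hK0 hK hSig, ← inner_sub_left, ← norm_tens]
    exact (abs_real_inner_le_norm _ _).trans (mul_le_mul_of_nonneg_right hS (norm_nonneg _))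
  set ζ := eigThreshold hSh r with hζ
  have hζh : ζ.IsHermitian := eigThreshold_isHermitian hSh r
  have hζlow : ∀ w : Vec p, σ ^ 2 / 2 * ‖w‖ ^ 2 ≤ ⟪act ζ w, w⟫ := fun w =>
    (mul_le_mul_of_nonneg_right (by linarith) (sq_nonneg _)).trans
      (hsp.le_inner_eigThreshold hSh hδq r w)
  have hζq : ∀ w : Vec p, |⟪act ζ w, w⟫ - ⟪act Sig w, w⟫| ≤ 3 * δ * ‖w‖ ^ 2 :=
    hsp.abs_inner_eigThreshold_sub_le hSh hδ0 hδq
  have hζb : ∀ v w : Vec p, |⟪act ζ v, w⟫ - ⟪act Sig v, w⟫| ≤ 3 * δ * ‖v‖ * ‖w‖ := fun v w => by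
    rw [← inner_sub_left, ← act_sub_left]
    refine abs_inner_act_le_of_abs_inner_le (hζh.sub hsp.isHermitian) (fun w => ?_) v w
    rw [act_sub_left, inner_sub_left]
    exact hζq w
  have hsb : ∀ v w : Vec p, |⟪act Sig v, w⟫| ≤ K * ‖v‖ * ‖w‖ := fun v w =>
    abs_inner_act_le_of_abs_inner_le hsp.isHermitian (abs_inner_act_cov_le hK0 hK hSig) v w
  have he2 := abs_empMu_le hn h2 x β
  have he4 := abs_empMu_le hn h4 x β
  have hm2 : m / 2 ≤ empMu 2 φ x β := by linarith [(abs_le.1 hμ2).1]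
  have hβ2 : ‖β‖ ^ 2 ≤ R ^ 2 := by gcongr
  -- Replacing `Σ` by `ζ` loses at most `ξ/4`, and the errors of the two sample means together lose
  -- at most another `ξ/4`.
  have hξ2 : ξ / 2 ≤ |empMu 2 φ x β + empMu 4 φ x β * ⟪act ζ β, β⟫| := by
    have e : popMu 2 φ ρ β + popMu 4 φ ρ β * ⟪act Sig β, β⟫ =
        (empMu 2 φ x β + empMu 4 φ x β * ⟪act ζ β, β⟫) -
        ((empMu 2 φ x β - popMu 2 φ ρ β) + empMu 4 φ x β * (⟪act ζ β, β⟫ - ⟪act Sig β, β⟫) +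
        (empMu 4 φ x β - popMu 4 φ ρ β) * ⟪act Sig β, β⟫) := by ring
    rw [e] at hξβ
    have t1 := abs_sub (empMu 2 φ x β + empMu 4 φ x β * ⟪act ζ β, β⟫)
      ((empMu 2 φ x β - popMu 2 φ ρ β) + empMu 4 φ x β * (⟪act ζ β, β⟫ - ⟪act Sig β, β⟫) +
        (empMu 4 φ x β - popMu 4 φ ρ β) * ⟪act Sig β, β⟫)
    have t2 := abs_add_three (empMu 2 φ x β - popMu 2 φ ρ β)
      (empMu 4 φ x β * (⟪act ζ β, β⟫ - ⟪act Sig β, β⟫))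
      ((empMu 4 φ x β - popMu 4 φ ρ β) * ⟪act Sig β, β⟫)
    have t3 : |empMu 4 φ x β * (⟪act ζ β, β⟫ - ⟪act Sig β, β⟫)| ≤ B₄ * (3 * δ * R ^ 2) := by
      rw [abs_mul]
      exact mul_le_mul he4 ((hζq β).trans (by gcongr)) (abs_nonneg _) hB4
    have t4 : |(empMu 4 φ x β - popMu 4 φ ρ β) * ⟪act Sig β, β⟫| ≤ ε * (K * R ^ 2) := by
      rw [abs_mul]
      exact mul_le_mul hμ4 ((abs_inner_act_cov_le hK0 hK hSig β).trans (by gcongr))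
        (abs_nonneg _) hε0
    linarith
  have hκ' : κ = (m / 2)⁻¹ * ((σ ^ 2 / 2)⁻¹ + B₄ / (ξ / 2) * R ^ 2) := by
    rw [hκ]
    field_simp
  have hκ0 : 0 ≤ κ := by
    rw [hκ]
    positivity
  refine norm_step_le (hφ.of_le (by norm_num)) hK0 hR hn hL hx hb hmin hζh
    (isUnit_det_of_inner_act_ge (by positivity) hζlow) (by linarith) ?_ hκ0 ?_ ?_
  · intro h0
    rw [h0, abs_zero] at hξ2
    linarith
  · intro v
    rw [hκ']
    exact norm_act_scaling_le (by linarith) (by positivity) (by linarith) hζlow hm2 he4 hβ hξ2 v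
  · intro w hw
    have q1 : |⟪act ζ w, w⟫ - ⟪act Sig w, w⟫| ≤ 3 * δ := by simpa [hw] using hζq w
    have q2 : |⟪act Sig w, w⟫| ≤ K := by simpa [hw] using hsb w w
    have q3 : |⟪act ζ β, w⟫ - ⟪act Sig β, w⟫| ≤ 3 * δ * R := by
      have := hζb β w
      rw [hw, mul_one] at this
      exact this.trans (by gcongr)
    have q4 : |⟪act Sig β, w⟫| ≤ K * R := by
      have := hsb β w
      rw [hw, mul_one] at this
      exact this.trans (by gcongr)
    have q5 := abs_hess_sub_le_bigDist hσ hsp hφ h2 h3 h4 hK0 hK hβ hw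
    have q6 : |∫ v, ⟪w, v⟫ ^ 2 * iteratedDeriv 2 φ ⟪v, β⟫ ∂ρ - ⟪act (empHess φ x β) w, w⟫| ≤ ε := by
      rw [← inner_integral_smul_tens (K := K)
        (continuous_iff_continuousAt.2 fun u => (hD 2 (by norm_num) u).continuousAt) h2 hK0 hK,
        inner_act_empHess, ← inner_sub_left]
      refine (abs_real_inner_le_norm _ _).trans ?_
      rw [norm_tens, hw, norm_sub_rev]
      simpa using hH
    have q7 : |⟪act ζ β, w⟫ + ⟪act Sig β, w⟫| ≤ R * (2 * K + 3) := by
      have e : ⟪act ζ β, w⟫ + ⟪act Sig β, w⟫ =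
        (⟪act ζ β, w⟫ - ⟪act Sig β, w⟫) + 2 * ⟪act Sig β, w⟫ := by ring
      rw [e]
      refine (abs_add_le _ _).trans ?_
      rw [abs_mul, abs_of_pos (zero_lt_two' ℝ)]
      -- `δ ≤ 1` is used here, to keep the final estimate linear in `δ`.
      have : 3 * δ * R ≤ 3 * R := by nlinarith
      linarith
    have e : empMu 2 φ x β * ⟪act ζ w, w⟫ + empMu 4 φ x β * ⟪act ζ β, w⟫ ^ 2 -
        ⟪act (empHess φ x β) w, w⟫ =
        (popMu 2 φ ρ β * ⟪act Sig w, w⟫ + popMu 4 φ ρ β * ⟪act Sig β, w⟫ ^ 2 -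
          ∫ v, ⟪w, v⟫ ^ 2 * iteratedDeriv 2 φ ⟪v, β⟫ ∂ρ) +
        (∫ v, ⟪w, v⟫ ^ 2 * iteratedDeriv 2 φ ⟪v, β⟫ ∂ρ - ⟪act (empHess φ x β) w, w⟫) +
        (empMu 2 φ x β * (⟪act ζ w, w⟫ - ⟪act Sig w, w⟫) +
          (empMu 2 φ x β - popMu 2 φ ρ β) * ⟪act Sig w, w⟫ +
          (empMu 4 φ x β * ((⟪act ζ β, w⟫ - ⟪act Sig β, w⟫) *
            (⟪act ζ β, w⟫ + ⟪act Sig β, w⟫)) +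
          (empMu 4 φ x β - popMu 4 φ ρ β) * (⟪act Sig β, w⟫ * ⟪act Sig β, w⟫))) := by ring
    rw [e]
    refine (abs_add_three _ _ _).trans ?_
    have s1 : |empMu 2 φ x β * (⟪act ζ w, w⟫ - ⟪act Sig w, w⟫)| ≤ B₂ * (3 * δ) := by
      rw [abs_mul]
      exact mul_le_mul he2 q1 (abs_nonneg _) hB2
    have s2 : |(empMu 2 φ x β - popMu 2 φ ρ β) * ⟪act Sig w, w⟫| ≤ ε * K := by
      rw [abs_mul]
      exact mul_le_mul hμ2 q2 (abs_nonneg _) hε0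
    have s3 : |empMu 4 φ x β * ((⟪act ζ β, w⟫ - ⟪act Sig β, w⟫) *
        (⟪act ζ β, w⟫ + ⟪act Sig β, w⟫))| ≤ B₄ * (3 * δ * R * (R * (2 * K + 3))) := by
      rw [abs_mul, abs_mul]
      exact mul_le_mul he4 (mul_le_mul q3 q7 (abs_nonneg _) (by positivity)) (by positivity) hB4
    have s4 : |(empMu 4 φ x β - popMu 4 φ ρ β) * (⟪act Sig β, w⟫ * ⟪act Sig β, w⟫)| ≤
        ε * (K * R * (K * R)) := by
      rw [abs_mul, abs_mul]
      exact mul_le_mul hμ4 (mul_le_mul q4 q4 (abs_nonneg _) (by positivity)) (by positivity) hε0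
    have s5 := abs_add_le (empMu 2 φ x β * (⟪act ζ w, w⟫ - ⟪act Sig w, w⟫) +
          (empMu 2 φ x β - popMu 2 φ ρ β) * ⟪act Sig w, w⟫)
          (empMu 4 φ x β * ((⟪act ζ β, w⟫ - ⟪act Sig β, w⟫) *
            (⟪act ζ β, w⟫ + ⟪act Sig β, w⟫)) +
          (empMu 4 φ x β - popMu 4 φ ρ β) * (⟪act Sig β, w⟫ * ⟪act Sig β, w⟫))
    have s6 := abs_add_le (empMu 2 φ x β * (⟪act ζ w, w⟫ - ⟪act Sig w, w⟫))
          ((empMu 2 φ x β - popMu 2 φ ρ β) * ⟪act Sig w, w⟫)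
    have s7 := abs_add_le (empMu 4 φ x β * ((⟪act ζ β, w⟫ - ⟪act Sig β, w⟫) *
            (⟪act ζ β, w⟫ + ⟪act Sig β, w⟫)))
          ((empMu 4 φ x β - popMu 4 φ ρ β) * (⟪act Sig β, w⟫ * ⟪act Sig β, w⟫))
    have hδpart : 0 ≤ (K + K ^ 2 * R ^ 2 + 1) * δ := by positivity
    have hεpart : 0 ≤ (3 * B₂ + 3 * B₄ * R ^ 2 * (2 * K + 3)) * ε := by positivity
    linarith

end Population

/-! ### The high-probability events -/

section Events

open Filter Topology

/-- For large `n` the grid has at most `n^(2p)` points and the discretization error, of order `1/n`,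
is below the statistical rate. The Lipschitz constant `L`, which carries `B₃` and `B₅`, thus affects
only how large `n` must be. -/
lemma eventually_sampleSize (p : ℕ) {R L M e : ℝ} (hR : 0 < R) (hM : 0 < M) (he : 0 < e) :
    ∀ᶠ n : ℕ in atTop, p ≤ n ∧ 3 ≤ n ∧ (2 * ⌈n * R⌉₊ + 1 : ℝ) ≤ (n : ℝ) ^ 2 ∧
      (1 ≤ p → 2 * (L * (p / n)) ≤ M * √(p * Real.log n / n)) ∧
      9 * M * √(p * Real.log n / n) ≤ e := by
  have hcast : Tendsto (fun n : ℕ => (n : ℝ)) atTop atTop := tendsto_natCast_atTop_atTop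
  have hlog : Tendsto (fun n : ℕ => 9 * M * √(p * Real.log n / n)) atTop (𝓝 0) := by
    have h0 : Tendsto (fun u : ℝ => Real.log u / u) atTop (𝓝 0) :=
      Real.isLittleO_log_id_atTop.tendsto_div_nhds_zero
    have h1 := ((h0.comp hcast).const_mul (p : ℝ)).sqrt.const_mul (9 * M)
    simp only [mul_zero, Real.sqrt_zero] at h1
    refine h1.congr fun n => ?_
    simp only [Function.comp_apply, mul_div_assoc]
  filter_upwards [eventually_ge_atTop p, eventually_ge_atTop 3,
    hcast.eventually_ge_atTop (2 * R + 3), hlog.eventually_le_const he,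
    (Real.tendsto_sqrt_atTop.comp hcast).eventually_ge_atTop (2 * L * p / M)]
    with n h1 h3 hnR he' hsq
  have hn3 : (3 : ℝ) ≤ n := by exact_mod_cast h3
  have hn : (0 : ℝ) < n := by linarith
  refine ⟨h1, h3, ?_, fun hp => ?_, he'⟩
  · have := (Nat.ceil_lt_add_one (show 0 ≤ n * R by positivity)).le
    nlinarith
  · have hp' : (1 : ℝ) ≤ p := by exact_mod_cast hp
    have hlog1 : 1 ≤ Real.log n := by
      rw [Real.le_log_iff_exp_le hn]
      exact Real.exp_one_lt_d9.le.trans (by linarith)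
    have hs : 1 / √(n : ℝ) ≤ √(p * Real.log n / n) := by
      rw [one_div, ← Real.sqrt_inv, inv_eq_one_div]
      apply Real.sqrt_le_sqrt
      gcongr
      nlinarith
    have hsn : 0 < √(n : ℝ) := Real.sqrt_pos.2 hn
    simp only [Function.comp_apply] at hsq
    rw [div_le_iff₀ hM] at hsq
    calc 2 * (L * (p / n)) = (2 * L * p) / n := by ring
      _ ≤ (√(n : ℝ) * M) / n := by gcongr
      _ = M * (1 / √(n : ℝ)) := by
          conv_lhs => rw [← Real.mul_self_sqrt hn.le]
          field_simp
          rw [Real.sqrt_sq hsn.le]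
      _ ≤ _ := by gcongr

lemma eventually_subsampleSize (p : ℕ) (K : ℝ) {d : ℝ} (hd : 0 < d) :
    ∀ᶠ s : ℕ in atTop, 8 * K * √(Real.log p / s) ≤ d := by
  have h : Tendsto (fun s : ℕ => 8 * K * √(Real.log p / s)) atTop (𝓝 0) := by
    have h1 := ((tendsto_natCast_atTop_atTop (R := ℝ)).const_div_atTop
      (Real.log p)).sqrt.const_mul (8 * K)
    simpa using h1
  exact h.eventually_le_const hd

lemma exp_one_sub_two_mul_log_le {p : ℕ} (hp : 0 < p) :
    Real.exp (1 - 2 * Real.log p) ≤ 3 / (p : ℝ) ^ 2 := by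
  have hp' : (0 : ℝ) < p := by exact_mod_cast hp
  rw [Real.exp_sub, show 2 * Real.log p = Real.log ((p : ℝ) ^ 2) by simp,
    Real.exp_log (by positivity)]
  gcongr
  exact Real.exp_one_lt_d9.le.trans (by norm_num)

variable {Ω : Type*} [MeasurableSpace Ω] {P : Measure Ω} [IsProbabilityMeasure P]
  {n p : ℕ} {ρ : Measure (Vec p)} [IsProbabilityMeasure ρ] {x : Fin n → Ω → Vec p}

/-- At deviation `8 M √(p log n / n)` each grid point has tail `exp (1 - 4 p log n)`; the `n^(2p)`
points use up half of the exponent. Discretization accounts for the ninth multiple of `M`. -/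
lemma measure_smean_uniform_rate_le {E : Type*} [NormedAddCommGroup E] [InnerProductSpace ℝ E]
    [MeasurableSpace E] [BorelSpace E] [FiniteDimensional ℝ E] (hp : 0 < p)
    (hx : ∀ i, Measurable (x i)) (hlaw : ∀ i, HasLaw (x i) ρ P) (hind : iIndepFun x P)
    {K : ℝ} (hK : ∀ᵐ v ∂ρ, ‖v‖ ≤ √K) {F : Vec p → Vec p → E} (hF : ∀ β, Measurable (F β))
    {M L R : ℝ} (hM : 0 < M) (hR : 0 < R) (hb : ∀ β v, ‖v‖ ≤ √K → ‖F β v‖ ≤ M) (hL0 : 0 ≤ L)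
    (hL : ∀ β β' v, ‖v‖ ≤ √K → ‖F β v - F β' v‖ ≤ L * ‖β - β'‖)
    (hpn : p ≤ n) (hn3 : 3 ≤ n) (hnR : (2 * ⌈n * R⌉₊ + 1 : ℝ) ≤ (n : ℝ) ^ 2)
    (hnL : 2 * (L * (p / n)) ≤ M * √(p * Real.log n / n)) :
    P.real {ω | ∃ β, ‖β‖ ≤ R ∧ 9 * M * √(p * Real.log n / n) <
        ‖smean (fun i => x i ω) Finset.univ (F β) - ∫ v, F β v ∂ρ‖} ≤ 3 / (p : ℝ) ^ 2 := by
  have hn : (0 : ℝ) < n := by exact_mod_cast (show 0 < n by omega)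
  have hn1 : (1 : ℝ) < n := by exact_mod_cast (show 1 < n by omega)
  have hp1 : (1 : ℝ) ≤ p := by exact_mod_cast hp
  have hlog : 0 < Real.log n := Real.log_pos hn1
  set q := √(p * Real.log n / n) with hq
  have hq0 : 0 < q := Real.sqrt_pos.2 (by positivity)
  have hq2 : q ^ 2 = p * Real.log n / n := Real.sq_sqrt (by positivity)
  have key := measure_smean_uniform_le hp (by omega) hx hlaw hind hK hF hM hR hb hL0 hL
    (ε := 8 * M * q) (by positivity)
  refine (measureReal_mono fun ω hω => ?_).trans (key.trans ?_)
  · obtain ⟨β, h1, h2⟩ := hω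
    exact ⟨β, h1, lt_of_le_of_lt (by linarith) h2⟩
  · have e1 : (n : ℝ) * (8 * M * q) ^ 2 / (16 * M ^ 2) = 4 * p * Real.log n := by
      rw [mul_pow, hq2]
      field_simp
      norm_num
    have e2 : ((n : ℝ) ^ 2) ^ p = Real.exp (2 * p * Real.log n) := by
      rw [← pow_mul, ← Real.exp_log (pow_pos hn (2 * p)), Real.log_pow]
      push_cast
      rfl
    rw [e1]
    calc _ ≤ ((n : ℝ) ^ 2) ^ p * Real.exp (1 - 4 * p * Real.log n) := by gcongr
      _ = Real.exp (1 - 2 * p * Real.log n) := by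
          rw [e2, ← Real.exp_add]
          congr 1
          ring
      _ ≤ Real.exp (1 - 2 * Real.log p) := by
          have h1 : Real.log p ≤ Real.log n :=
            Real.log_le_log (by linarith) (by exact_mod_cast hpn)
          rw [Real.exp_le_exp]
          nlinarith
      _ ≤ _ := exp_one_sub_two_mul_log_le hp

lemma measure_subsample_rate_le (hp : 2 ≤ p) (hx : ∀ i, Measurable (x i))
    (hlaw : ∀ i, HasLaw (x i) ρ P) (hind : iIndepFun x P) {K : ℝ} (hK0 : 0 < K)
    (hK : ∀ᵐ v ∂ρ, ‖v‖ ≤ √K) {s : ℕ} (hs : 0 < s) {S : Ω → Finset (Fin n)}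
    (hS : IsUniformSubsample s S P) (hSx : IndepFun S (fun ω i => x i ω) P) :
    P.real {ω | 8 * K * √(Real.log p / s) ≤
      ‖smean (fun i => x i ω) (S ω) tens - ∫ v, tens v ∂ρ‖} ≤ 3 / (p : ℝ) ^ 2 := by
  have hs' : (0 : ℝ) < s := by exact_mod_cast hs
  have hlog : 0 < Real.log p := Real.log_pos (by exact_mod_cast (show 1 < p by omega))
  have hq2 : √(Real.log p / s) ^ 2 = Real.log p / s := Real.sq_sqrt (by positivity)
  have hq0 : 0 < √(Real.log p / s) := Real.sqrt_pos.2 (by positivity)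
  refine (measure_smean_subsample_ge_le hx hlaw hind hS hSx hs continuous_tens.measurable hK0 (by
    filter_upwards [hK] with v hv
    rw [norm_tens, ← Real.sq_sqrt hK0.le]
    gcongr) (by positivity)).trans ?_
  have e1 : (s : ℝ) * (8 * K * √(Real.log p / s)) ^ 2 / (16 * K ^ 2) = 4 * Real.log p := by
    rw [mul_pow, hq2]
    field_simp
    norm_num
  rw [e1]
  refine le_trans (Real.exp_le_exp.2 ?_) (exp_one_sub_two_mul_log_le (by omega))
  linarith

/-- The sets need not be measurable: subadditivity and `P (A ∩ E) ≤ P.restrict E A` hold for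
arbitrary sets. -/
lemma one_sub_le_cond_real {E A D : Set Ω} (h : E \ D ⊆ A) {π₀ q : ℝ}
    (hπ₀ : 0 < π₀) (hE : π₀ ≤ P.real E) (hD : P.real D ≤ q) :
    1 - q / π₀ ≤ (cond P E).real A := by
  have hE0 : 0 < P.real E := hπ₀.trans_le hE
  have h1 : (cond P E).real A = (P.real E)⁻¹ * (P.restrict E).real A := by
    simp [ProbabilityTheory.cond, Measure.real]
  have h2 : P.real (A ∩ E) ≤ (P.restrict E).real A :=
    ENNReal.toReal_mono (measure_ne_top _ _) (Measure.le_restrict_apply _ _)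
  have h3 : P.real E ≤ P.real (A ∩ E) + P.real D := by
    refine (measureReal_mono fun ω hω => ?_).trans (measureReal_union_le _ _)
    by_cases hd : ω ∈ D
    · exact Or.inr hd
    · exact Or.inl ⟨h ⟨hω, hd⟩, hω⟩
  have hq : 0 ≤ q := measureReal_nonneg.trans hD
  rw [h1]
  calc 1 - q / π₀ ≤ 1 - q / P.real E := by gcongr
    _ = (P.real E)⁻¹ * (P.real E - q) := by field_simp
    _ ≤ _ := by
        gcongr
        linarith

end Events

/-! ### Bounds on the iterates and the covariates. -/

lemma norm_iterate_le {n p : ℕ} {φ : ℝ → ℝ} {R γ : ℝ} (hR : 0 < R) {r : Fin p} {β₀ : Vec p}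
    (x : Fin n → Vec p) (y : Fin n → ℝ) (S : Finset (Fin n)) {t : ℕ} (h : 0 < t ∨ ‖β₀‖ ≤ R) :
    ‖iterate φ R γ r β₀ x y S t‖ ≤ R := by
  cases t with
  | zero => simpa [iterate] using h
  | succ t => exact norm_projBall_le hR _

lemma measure_norm_not_le_eq_zero {Ω : Type*} [MeasurableSpace Ω] {P : Measure Ω} {n p : ℕ}
    {ρ : Measure (Vec p)} {x : Fin n → Ω → Vec p} {K : ℝ} (hx : ∀ i, Measurable (x i))
    (hlaw : ∀ i, HasLaw (x i) ρ P) (hK : ∀ᵐ v ∂ρ, ‖v‖ ≤ √K) :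
    P.real {ω | ¬ ∀ i, ‖x i ω‖ ≤ √K} = 0 := by
  have : ∀ᵐ ω ∂P, ∀ i, ‖x i ω‖ ≤ √K := by
    rw [ae_all_iff]
    intro i
    have h := hK
    rw [← (hlaw i).map_eq] at h
    exact ae_of_ae_map (hx i).aemeasurable h
  rw [Measure.real, ae_iff.1 this, ENNReal.toReal_zero]

/-- Lets a single `M` and a single `L` serve the scalar means and the Hessian alike, the latter
having an extra factor `K`. -/
lemma le_add_mul_add_one {a b k : ℝ} (ha : 0 ≤ a) (hb : 0 ≤ b) (hk : 0 ≤ k) :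
    a ≤ (a + b) * (k + 1) ∧ b ≤ (a + b) * (k + 1) ∧ a * k ≤ (a + b) * (k + 1) := by
  have h1 := mul_nonneg ha hk
  have h2 := mul_nonneg hb hk
  have h3 : (a + b) * (k + 1) = a * k + b * k + a + b := by ring
  exact ⟨by linarith, by linarith, by linarith⟩

/-! ### Uniform concentration for the sample means of derivatives and the Hessian. -/

section Families

variable {p : ℕ} {φ : ℝ → ℝ} {K B B' : ℝ} {k : ℕ}

lemma abs_iteratedDeriv_inner_sub_le (hφ : ContDiff ℝ 5 φ) (hk : k < 5)
    (hB' : ∀ a, |iteratedDeriv (k + 1) φ a| ≤ B') {v : Vec p} (hv : ‖v‖ ≤ √K) (β β' : Vec p) :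
    |iteratedDeriv k φ ⟪v, β⟫ - iteratedDeriv k φ ⟪v, β'⟫| ≤ B' * √K * ‖β - β'‖ := by
  have hB0 : 0 ≤ B' := (abs_nonneg _).trans (hB' 0)
  refine (abs_sub_le_of_abs_deriv_le (hasDerivAt_iteratedDeriv (N := 5) hφ hk) hB' _ _).trans ?_
  rw [← inner_sub_right, mul_assoc]
  gcongr
  exact (abs_real_inner_le_norm v _).trans (by gcongr)

lemma norm_iteratedDeriv_smul_tens_sub_le (hφ : ContDiff ℝ 5 φ) (hk : k < 5) (hK0 : 0 ≤ K)
    (hB' : ∀ a, |iteratedDeriv (k + 1) φ a| ≤ B') {v : Vec p} (hv : ‖v‖ ≤ √K) (β β' : Vec p) :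
    ‖iteratedDeriv k φ ⟪v, β⟫ • tens v - iteratedDeriv k φ ⟪v, β'⟫ • tens v‖ ≤
      B' * √K * K * ‖β - β'‖ := by
  have hB0 : 0 ≤ B' := (abs_nonneg _).trans (hB' 0)
  have hv2 : ‖v‖ ^ 2 ≤ K := by
    rw [← Real.sq_sqrt hK0]
    gcongr
  rw [← sub_smul, norm_smul, norm_tens, Real.norm_eq_abs]
  calc _ ≤ B' * √K * ‖β - β'‖ * K := mul_le_mul (abs_iteratedDeriv_inner_sub_le hφ hk hB' hv β β')
        hv2 (sq_nonneg _) (by positivity)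
    _ = _ := by ring

variable {Ω : Type*} [MeasurableSpace Ω] {P : Measure Ω} [IsProbabilityMeasure P]
  {n : ℕ} {ρ : Measure (Vec p)} [IsProbabilityMeasure ρ] {x : Fin n → Ω → Vec p} {M L R : ℝ}

lemma measure_empMu_rate_le (hφ : ContDiff ℝ 5 φ) (hk : k < 5)
    (hB : ∀ a, |iteratedDeriv k φ a| ≤ B) (hB' : ∀ a, |iteratedDeriv (k + 1) φ a| ≤ B')
    (hp : 0 < p) (hx : ∀ i, Measurable (x i)) (hlaw : ∀ i, HasLaw (x i) ρ P)
    (hind : iIndepFun x P) (hK : ∀ᵐ v ∂ρ, ‖v‖ ≤ √K) (hM : 0 < M) (hR : 0 < R) (hBM : B ≤ M)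
    (hL0 : 0 ≤ L) (hBL : B' * √K ≤ L) (hpn : p ≤ n) (hn3 : 3 ≤ n)
    (hnR : (2 * ⌈n * R⌉₊ + 1 : ℝ) ≤ (n : ℝ) ^ 2)
    (hnL : 2 * (L * (p / n)) ≤ M * √(p * Real.log n / n)) :
    P.real {ω | ∃ β, ‖β‖ ≤ R ∧ 9 * M * √(p * Real.log n / n) <
        |empMu k φ (fun i => x i ω) β - popMu k φ ρ β|} ≤ 3 / (p : ℝ) ^ 2 := by
  have hc : Continuous (iteratedDeriv k φ) := continuous_iff_continuousAt.2 fun u =>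
    (hasDerivAt_iteratedDeriv (N := 5) hφ hk u).continuousAt
  have h := measure_smean_uniform_rate_le (P := P) (n := n) hp hx hlaw hind hK
    (F := fun β v => iteratedDeriv k φ ⟪v, β⟫)
    (fun β => Continuous.measurable (by fun_prop)) hM hR (fun β v _ => (hB _).trans hBM) hL0
    (fun β β' v hv => (abs_iteratedDeriv_inner_sub_le hφ hk hB' hv β β').trans
      (mul_le_mul_of_nonneg_right hBL (norm_nonneg _))) hpn hn3 hnR hnL
  simp only [empMu_eq_smean]
  exact h

lemma measure_empHess_rate_le (hφ : ContDiff ℝ 5 φ) (hk : k < 5)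
    (hB : ∀ a, |iteratedDeriv k φ a| ≤ B) (hB' : ∀ a, |iteratedDeriv (k + 1) φ a| ≤ B')
    (hp : 0 < p) (hx : ∀ i, Measurable (x i)) (hlaw : ∀ i, HasLaw (x i) ρ P)
    (hind : iIndepFun x P) (hK0 : 0 ≤ K) (hK : ∀ᵐ v ∂ρ, ‖v‖ ≤ √K) (hM : 0 < M) (hR : 0 < R)
    (hBM : B * K ≤ M) (hL0 : 0 ≤ L) (hBL : B' * √K * K ≤ L) (hpn : p ≤ n) (hn3 : 3 ≤ n)
    (hnR : (2 * ⌈n * R⌉₊ + 1 : ℝ) ≤ (n : ℝ) ^ 2)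
    (hnL : 2 * (L * (p / n)) ≤ M * √(p * Real.log n / n)) :
    P.real {ω | ∃ β, ‖β‖ ≤ R ∧ 9 * M * √(p * Real.log n / n) <
        ‖smean (fun i => x i ω) Finset.univ (fun v => iteratedDeriv k φ ⟪v, β⟫ • tens v) -
          ∫ v, iteratedDeriv k φ ⟪v, β⟫ • tens v ∂ρ‖} ≤ 3 / (p : ℝ) ^ 2 := by
  have hc : Continuous (iteratedDeriv k φ) := continuous_iff_continuousAt.2 fun u =>
    (hasDerivAt_iteratedDeriv (N := 5) hφ hk u).continuousAt
  have ht := continuous_tens (p := p)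
  refine measure_smean_uniform_rate_le (P := P) (n := n) hp hx hlaw hind hK
    (F := fun β v => iteratedDeriv k φ ⟪v, β⟫ • tens v)
    (fun β => Continuous.measurable (by fun_prop)) hM hR (fun β v hv => ?_) hL0
    (fun β β' v hv => (norm_iteratedDeriv_smul_tens_sub_le hφ hk hK0 hB' hv β β').trans
      (mul_le_mul_of_nonneg_right hBL (norm_nonneg _))) hpn hn3 hnR hnL
  have hv2 : ‖v‖ ^ 2 ≤ K := by
    rw [← Real.sq_sqrt hK0]
    gcongr
  rw [norm_smul, norm_tens]
  exact (mul_le_mul (hB _) hv2 (sq_nonneg _) ((abs_nonneg _).trans (hB 0))).trans hBM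

end Families

end NewtonStein

end

/-! ### Choice of constants and assembly. -/

theorem mainTheorem1 (K R π₀ B₂ B₄ : ℝ) (hK : 0 < K) (hR : 0 < R) (hπ₀ : 0 < π₀) :
    ∃ c c₁ c₂ : ℝ, 0 < c ∧ 0 < c₁ ∧ 0 < c₂ ∧
    ∀ (p : ℕ) (r : Fin p), 2 ≤ p →
    ∀ (B₃ B₅ σ ξ m : ℝ), 0 < σ → 0 < ξ → 0 < m →
    ∃ N : ℕ, ∀ n s : ℕ, N ≤ n → N ≤ s → s ≤ n →
    -- the cumulant generating function
    ∀ φ : ℝ → ℝ, ContDiff ℝ 5 φ →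
      (∀ a, |iteratedDeriv 2 φ a| ≤ B₂) → (∀ a, |iteratedDeriv 3 φ a| ≤ B₃) →
      (∀ a, |iteratedDeriv 4 φ a| ≤ B₄) → (∀ a, |iteratedDeriv 5 φ a| ≤ B₅) →
    -- the law of a covariate
    ∀ (Sig : Matrix (Fin p) (Fin p) ℝ) (ρ : Measure (NewtonStein.Vec p)),
      NewtonStein.IsSpiked r σ Sig → IsProbabilityMeasure ρ →
      (∀ᵐ v ∂ρ, ‖v‖ ≤ Real.sqrt K) → (∫ v, v ∂ρ = 0) →
      (∀ j k, ∫ v, v j * v k ∂ρ = Sig j k) →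
      (∀ β : NewtonStein.Vec p, ‖β‖ ≤ R → m ≤ NewtonStein.popMu 2 φ ρ β) →
    -- the data, the sub-sample, the optimal value and the iterates
    ∀ (Ω : Type*) (_ : MeasurableSpace Ω) (P : Measure Ω), IsProbabilityMeasure P →
    ∀ (x : Fin n → Ω → NewtonStein.Vec p) (y : Fin n → Ω → ℝ) (S : Ω → Finset (Fin n))
      (βs : Ω → NewtonStein.Vec p) (β₀ : NewtonStein.Vec p) (t : ℕ) (βh : ℕ → Ω → NewtonStein.Vec p)
      (E : Set Ω),
      (∀ i, Measurable (x i)) → (∀ i, HasLaw (x i) ρ P) → iIndepFun x P →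
      (∀ i, Measurable (y i)) → Measurable βs →
      NewtonStein.IsUniformSubsample s S P → IndepFun S (fun ω i => x i ω) P →
      (0 < t ∨ ‖β₀‖ ≤ R) →
      (βh = fun t ω => NewtonStein.iterate φ R 1 r β₀ (fun i => x i ω) (fun i => y i ω) (S ω) t) →
      (E = NewtonStein.goodEvent φ ρ Sig R ξ
        (fun ω => NewtonStein.negLogLik φ (fun i => x i ω) (fun i => y i ω)) (βh t) βs) →
      π₀ ≤ P.real E →
    ∀ κ τ₁ τ₂ : ℝ,
      κ = 2 / m * (2 / σ ^ 2 + 2 * B₄ * R ^ 2 / ξ) →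
      τ₁ = κ * NewtonStein.bigDist φ R Sig ρ (multivariateGaussian 0 Sig) +
        c₁ * κ * Real.sqrt (p / min (p / Real.log p * s) (n / Real.log n)) →
      τ₂ = c₂ * κ →
      1 - c / (p : ℝ) ^ 2 ≤ (cond P E).real
        {ω | ‖βh (t + 1) ω - βs ω‖ ≤ τ₁ * ‖βh t ω - βs ω‖ + τ₂ * ‖βh t ω - βs ω‖ ^ 2} := by
  have hM : 0 < (|B₂| + |B₄| + 1) * (K + 1) := by positivity
  -- `12` is four times `3`, one for each bad event. The absolute values are there because the signs
  -- of `B₂` and `B₄` are known only once `φ` is given; the final `+ 1` keeps `c₂` positive when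
  -- both vanish.
  refine ⟨12 / π₀,
    (3 * |B₂| + 3 * |B₄| * R ^ 2 * (2 * K + 3) + K + K ^ 2 * R ^ 2 + 1) *
      (8 * K + 9 * ((|B₂| + |B₄| + 1) * (K + 1))),
    (2 * |B₂| + |B₄|) * (√K * K) + 1, by positivity, by positivity, by positivity, ?_⟩
  intro p r hp B₃ B₅ σ ξ m hσ hξ hm
  set M : ℝ := (|B₂| + |B₄| + 1) * (K + 1) with hMdef
  set L : ℝ := (|B₃| + |B₅|) * √K * (K + 1) with hLdef
  have hL0 : 0 ≤ L := by positivity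
  -- These minima encode the smallness conditions on `ε` and `δ` in `norm_newtonStein_step_le`; the
  -- `+ 1` in the second denominator covers `B₄ = 0`.
  have he : 0 < min (m / 2) (ξ / (4 * (1 + K * R ^ 2))) := by positivity
  have hd : 0 < min (min 1 (σ ^ 2 / 2)) (ξ / (4 * (3 * |B₄| * R ^ 2 + 1))) := by positivity
  obtain ⟨N, hN⟩ := Filter.eventually_atTop.1
    ((NewtonStein.eventually_sampleSize p hR hM he (L := L)).and
      ((NewtonStein.eventually_subsampleSize p K hd).and (Filter.eventually_ge_atTop 1)))
  refine ⟨N, ?_⟩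
  intro n s hnN hsN hsn φ hφ h2 h3 h4 h5 Sig ρ hsp hρ hKρ hmean hSig hmμ Ω _ P hP x y S βs β₀ t βh
    E hx hlaw hind hy hβs hS hSx ht hβh hE hπE κ τ₁ τ₂ hκ hτ₁ hτ₂
  obtain ⟨⟨hpn, hn3, hnR, hnL, hne⟩, -, -⟩ := hN n hnN
  obtain ⟨-, hsd, hs1⟩ := hN s hsN
  have hnL := hnL (by omega)
  have hB2 : |B₂| = B₂ := abs_of_nonneg ((abs_nonneg _).trans (h2 0))
  have hB3 : |B₃| = B₃ := abs_of_nonneg ((abs_nonneg _).trans (h3 0))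
  have hB4 : |B₄| = B₄ := abs_of_nonneg ((abs_nonneg _).trans (h4 0))
  have hB5 : |B₅| = B₅ := abs_of_nonneg ((abs_nonneg _).trans (h5 0))
  rw [hB2, hB4] at hMdef
  rw [hB3, hB5] at hLdef
  rw [hB4] at hsd hd
  rw [hB2, hB4] at hτ₁ hτ₂
  have hB20 : 0 ≤ B₂ := hB2 ▸ abs_nonneg _
  have hB30 : 0 ≤ B₃ := hB3 ▸ abs_nonneg _
  have hB40 : 0 ≤ B₄ := hB4 ▸ abs_nonneg _
  have hB50 : 0 ≤ B₅ := hB5 ▸ abs_nonneg _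
  set δ : ℝ := 8 * K * √(Real.log p / s) with hδ
  set ε : ℝ := 9 * M * √(p * Real.log n / n) with hε
  have hsK : 0 ≤ √K := Real.sqrt_nonneg K
  obtain ⟨hM2, hM4', hMH⟩ := NewtonStein.le_add_mul_add_one hB20
    (add_nonneg hB40 zero_le_one) hK.le
  rw [← add_assoc, ← hMdef] at hM2 hM4' hMH
  have hM4 : B₄ ≤ M := (le_add_of_nonneg_right zero_le_one).trans hM4'
  obtain ⟨hL3, hL5, hLH⟩ := NewtonStein.le_add_mul_add_one (mul_nonneg hB30 hsK)
    (mul_nonneg hB50 hsK) hK.le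
  rw [← add_mul, ← hLdef] at hL3 hL5 hLH
  have hp0 : 0 < p := by omega
  have bad1 := NewtonStein.measure_subsample_rate_le hp hx hlaw hind hK hKρ
    (by omega : 0 < s) hS hSx
  have bad2 := NewtonStein.measure_empMu_rate_le (n := n) hφ (by norm_num) h2 h3 hp0 hx hlaw hind
    hKρ hM hR hM2 hL0 hL3 hpn hn3 hnR hnL
  have bad4 := NewtonStein.measure_empMu_rate_le (n := n) hφ (by norm_num) h4 h5 hp0 hx hlaw hind
    hKρ hM hR hM4 hL0 hL5 hpn hn3 hnR hnL
  have badH := NewtonStein.measure_empHess_rate_le (n := n) hφ (by norm_num) h2 h3 hp0 hx hlaw hind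
    hK.le hKρ hM hR hMH hL0 hLH hpn hn3 hnR hnL
  have badx := NewtonStein.measure_norm_not_le_eq_zero (n := n) hx hlaw hKρ
  rw [← hδ] at bad1
  rw [← hε] at bad2 bad4 badH
  -- The null event that some covariate exceeds `√K` joins the four bad events, so that the rest of
  -- the argument is deterministic.
  have hbad := (measureReal_union_le _ _).trans (add_le_add ((measureReal_union_le _ _).trans
    (add_le_add bad1 bad2)) ((measureReal_union_le _ _).trans (add_le_add bad4
      ((measureReal_union_le _ _).trans (add_le_add badH badx.le)))))
  refine le_trans (le_of_eq ?_) (NewtonStein.one_sub_le_cond_real ?_ hπ₀ hπE hbad)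
  · field_simp
    ring
  rintro ω ⟨hωE, hω⟩
  simp only [Set.mem_union, Set.mem_ofPred_eq, not_or, not_exists, not_and, not_lt, not_le,
    not_not] at hω
  obtain ⟨⟨g1, g2⟩, g4, gH, gx⟩ := hω
  rw [hE] at hωE
  obtain ⟨e1, e2, e3⟩ := hωE
  set β := βh t ω with hβdef
  have hβR : ‖β‖ ≤ R := by
    rw [hβdef, hβh]
    exact NewtonStein.norm_iterate_le hR _ _ _ ht
  have hstep : βh (t + 1) ω = NewtonStein.projBall R (β - (1 : ℝ) • NewtonStein.act
      (NewtonStein.scaling φ (fun i => x i ω) (NewtonStein.eigThreshold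
        (NewtonStein.subCov_isHermitian (fun i => x i ω) (S ω)) r) β)
      (gradient (NewtonStein.negLogLik φ (fun i => x i ω) (fun i => y i ω)) β)) := by
    rw [hβdef, hβh]
    rfl
  have hδs := le_min_iff.1 hsd
  have hδs' := le_min_iff.1 hδs.1
  have hεs := le_min_iff.1 hne
  have key := NewtonStein.norm_newtonStein_step_le (n := n) (by omega) (r := r) hσ hm hξ hR hK.le
    hsp hφ h2 h3 h4 hKρ hSig hδs'.1 hδs'.2 (by
      have h := (le_div_iff₀ (by positivity)).1 hδs.2
      have : 0 ≤ δ := by positivity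
      linarith) hεs.1 (by
      have h := (le_div_iff₀ (by positivity)).1 hεs.2
      linarith) gx (y := fun i => y i ω) (S := S ω) hβR e3 (hmμ β hβR) e2 e1 g1.le
    (g2 β hβR) (g4 β hβR) (gH β hβR) hκ
  rw [← hstep] at key
  refine key.trans ?_
  have hn1 : (1 : ℝ) < n := by exact_mod_cast (show 1 < n by omega)
  have hp1 : (1 : ℝ) < p := by exact_mod_cast (show 1 < p by omega)
  have hs0 : (0 : ℝ) < s := by exact_mod_cast (show 0 < s by omega)
  have hlogn := Real.log_pos hn1
  have hlogp := Real.log_pos hp1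
  -- The two arguments of the minimum correspond to `√(log p / s)`, the sub-sampling rate, and `√(p
  -- log n / n)`, the uniform rate.
  set q := √(p / min (p / Real.log p * s) (n / Real.log n)) with hq
  have hmin : 0 < min (p / Real.log p * s) (n / Real.log n) := by positivity
  have hq1 : √(Real.log p / s) ≤ q := by
    refine Real.sqrt_le_sqrt ?_
    calc Real.log p / s = p / (p / Real.log p * s) := by field_simp
      _ ≤ _ := div_le_div_of_nonneg_left (by positivity) hmin (min_le_left _ _)
  have hq2 : √(p * Real.log n / n) ≤ q := by
    refine Real.sqrt_le_sqrt ?_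
    calc p * Real.log n / n = p / (n / Real.log n) := by field_simp
      _ ≤ _ := div_le_div_of_nonneg_left (by positivity) hmin (min_le_right _ _)
  have hδε : δ + ε ≤ (8 * K + 9 * M) * q := by
    rw [add_mul]
    exact add_le_add (by rw [hδ]; gcongr) (by rw [hε]; gcongr)
  have hκ0 : 0 ≤ κ := by
    rw [hκ]
    positivity
  rw [hτ₁, hτ₂]
  refine add_le_add (mul_le_mul_of_nonneg_right ?_ (norm_nonneg _))
    (mul_le_mul_of_nonneg_right ?_ (sq_nonneg _))
  · rw [mul_add]
    refine add_le_add le_rfl ?_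
    calc _ ≤ κ * ((3 * B₂ + 3 * B₄ * R ^ 2 * (2 * K + 3) + K + K ^ 2 * R ^ 2 + 1) *
          ((8 * K + 9 * M) * q)) := by gcongr
      _ = _ := by ring
  · linarith
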